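/- Let $D=(V+r,E)$ be a finite acyclic directed graph with root node $r$ (parallel edges are allowed) and let $w:E\to\mathbb{Q}_{\ge 0}$ be a weight function. For $F\subseteq E$ and $v\in V$ let $\lambda_F(r,v)$ be the maximum number of pairwise edge-disjoint directed paths from $r$ to $v$ that use only edges of $F$, let $\varrho_F(v)$ be the number of edges of $F$ entering $v$, and put $\lambda_D=\lambda_E$. A maximal flame in $D$ is a set $F\subseteq E$ such that $\lambda_D(r,v)=\lambda_F(r,v)=\varrho_F(v)$ for every $v\in V$. Then a maximal flame in $D$ of minimum total weight $\sum_{e\in F}w(e)$ can be found in $O(|E|^2)$ time. That is, there are a single random access machine program and a constant $C$ such that for every such $D$ and $w$ the program, given the root, the list of the edges of $D$ (each as a pair of node numbers) and the list of their weights, halts after at most $C(|E|^2+1)$ steps with the characteristic vector of a minimum weight maximal flame in $D$ as its output. Here the memory is initially zero outside the input; each memory access, increment or decrement of a natural number, comparison of two natural numbers, Boolean operation, control-flow instruction, and comparison of two weights counts as one step up to a constant factor, and the program accesses the weights only by comparing them. -/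

import Mathlib

/-- A directed graph with node set `V` (root included), edge set `E` (parallel edges allowed)
and a designated root node. -/
structure RootedDigraph (V E : Type*) where
  root : V
  tail : E → V
  head : E → V

namespace RootedDigraph

/-- `D.IsWalk u v p`: the edges of the list `p` form, in this order, a directed walk
from `u` to `v`. -/
def IsWalk {V E : Type*} (D : RootedDigraph V E) : V → V → List E → Prop
  | u, v, [] => u = v
  | u, v, e :: p => D.tail e = u ∧ D.IsWalk (D.head e) v p

/-- A directed path: a directed walk that visits no node twice. -/
def IsPath {V E : Type*} (D : RootedDigraph V E) (u v : V) (p : List E) : Prop :=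
  D.IsWalk u v p ∧ (u :: p.map D.head).Nodup

/-- There is no directed cycle (equivalently, no nonempty closed directed walk). -/
def Acyclic {V E : Type*} (D : RootedDigraph V E) : Prop :=
  ∀ (v : V) (p : List E), p ≠ [] → ¬ D.IsWalk v v p

/-- There are `k` pairwise edge-disjoint paths from the root to `v` that use edges of `F` only. -/
def HasDisjointPaths {V E : Type*} (D : RootedDigraph V E) (F : Finset E) (v : V) (k : ℕ) : Prop :=
  ∃ P : Fin k → List E,
    (∀ i, D.IsPath D.root v (P i) ∧ ∀ e ∈ P i, e ∈ F) ∧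
    ∀ i j, i ≠ j → List.Disjoint (P i) (P j)

/-- The local edge-connectivity `λ_F(r, v)` from the root `r` to `v` in the spanning subgraph with
edge set `F`: the maximum number of pairwise edge-disjoint paths from `r` to `v`.
It is used for `v ≠ r` only, where the supremum is a maximum (see `bddAbove_hasDisjointPaths`). -/
noncomputable def localConn {V E : Type*} (D : RootedDigraph V E) (F : Finset E) (v : V) : ℕ :=
  sSup {k | D.HasDisjointPaths F v k}

theorem bddAbove_hasDisjointPaths {V E : Type*} (D : RootedDigraph V E) (F : Finset E) (v : V)
    (hv : v ≠ D.root) : BddAbove {k | D.HasDisjointPaths F v k} := by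
  refine ⟨F.card, ?_⟩
  rintro k ⟨P, hP, hdisj⟩
  have hne : ∀ i, ∃ e, e ∈ P i := by
    intro i
    rcases hp : P i with _ | ⟨e, p⟩
    · have h := (hP i).1.1
      rw [hp] at h
      exact absurd h.symm hv
    · exact ⟨e, by simp⟩
  choose f hf using hne
  have hinj : Function.Injective f := by
    intro i j hij
    by_contra h
    exact hdisj i j h (hf i) (hij ▸ hf j)
  have := Finset.card_le_card_of_injOn (s := (Finset.univ : Finset (Fin k))) (t := F) f
    (fun i _ => (hP i).2 _ (hf i)) (fun i _ j _ h => hinj h)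
  simpa using this

/-- The in-degree of `v` in the spanning subgraph with edge set `F`. -/
def inDegree {V E : Type*} [DecidableEq V] (D : RootedDigraph V E) (F : Finset E) (v : V) : ℕ :=
  (F.filter (fun e => D.head e = v)).card

/-- The spanning subgraph with edge set `F` is a flame. -/
def IsFlame {V E : Type*} [DecidableEq V] (D : RootedDigraph V E) (F : Finset E) : Prop :=
  ∀ v, v ≠ D.root → D.localConn F v = D.inDegree F v

/-- A maximal flame of `D`: a flame with the same local edge-connectivities from the root as `D`. -/
def IsMaximalFlame {V E : Type*} [DecidableEq V] [Fintype E] (D : RootedDigraph V E)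
    (F : Finset E) : Prop :=
  D.IsFlame F ∧ ∀ v, v ≠ D.root → D.localConn F v = D.localConn Finset.univ v

/-- `F` is a maximal flame of `D` of minimum total weight. -/
def IsMinWeightMaximalFlame {V E : Type*} [DecidableEq V] [Fintype E] (D : RootedDigraph V E)
    (w : E → ℚ≥0) (F : Finset E) : Prop :=
  D.IsMaximalFlame F ∧ ∀ F', D.IsMaximalFlame F' → ∑ e ∈ F, w e ≤ ∑ e ∈ F', w e

end RootedDigraph

/-! ### A random access machine

Programs work on natural-number variables and on zero-initialised arrays of natural numbers with
random access; a program names finitely many of both. Numbers are changed only by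
`± 1`, so they never exceed the largest number in the program and its input by more than
the running time. The weights lie in a read-only array of rationals and can only
be compared with one another. Every operation and every memory access costs one time unit. -/

namespace RAM

/-- Number-valued expressions; `get a i` is the entry of array number `a` at index `i`. -/
inductive Expr : Type
  | const (c : ℕ) : Expr
  | var (x : ℕ) : Expr
  | get (a : ℕ) (i : Expr) : Expr
  | succ (e : Expr) : Expr
  | pred (e : Expr) : Expr

/-- Boolean tests; `weightLE i j` compares the weights stored at the indices `i` and `j`. -/
inductive Test : Type
  | eq (e f : Expr) : Test
  | lt (e f : Expr) : Test
  | weightLE (i j : Expr) : Test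
  | not (b : Test) : Test
  | and (b c : Test) : Test

/-- Programs: `assign x e` is `x := e`, and `store a i e` is `a[i] := e`. -/
inductive Program : Type
  | skip : Program
  | assign (x : ℕ) (e : Expr) : Program
  | store (a : ℕ) (i e : Expr) : Program
  | seq (p q : Program) : Program
  | branch (b : Test) (p q : Program) : Program
  | loop (b : Test) (p : Program) : Program

/-- Contents of the variables and of the arrays. -/
structure State where
  var : ℕ → ℕ
  arr : ℕ → ℕ → ℕ

def Expr.eval (s : State) : Expr → ℕ
  | .const c => c
  | .var x => s.var x
  | .get a i => s.arr a (i.eval s)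
  | .succ e => e.eval s + 1
  | .pred e => e.eval s - 1

/-- Time needed to evaluate an expression. -/
def Expr.cost : Expr → ℕ
  | .const _ => 1
  | .var _ => 1
  | .get _ i => i.cost + 1
  | .succ e => e.cost + 1
  | .pred e => e.cost + 1

/-- Truth value of a test in the state `s`, where `w` is the array of weights. -/
def Test.Holds (w : ℕ → ℚ≥0) (s : State) : Test → Prop
  | .eq e f => e.eval s = f.eval s
  | .lt e f => e.eval s < f.eval s
  | .weightLE i j => w (i.eval s) ≤ w (j.eval s)
  | .not b => ¬ b.Holds w s
  | .and b c => b.Holds w s ∧ c.Holds w s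

/-- Time needed to evaluate a test. -/
def Test.cost : Test → ℕ
  | .eq e f => e.cost + f.cost + 1
  | .lt e f => e.cost + f.cost + 1
  | .weightLE i j => i.cost + j.cost + 1
  | .not b => b.cost + 1
  | .and b c => b.cost + c.cost + 1

/-- `Runs w p s s' t`: with weights `w`, the program `p` started in the state `s` halts after exactly
`t` time units in the state `s'`. -/
inductive Runs (w : ℕ → ℚ≥0) : Program → State → State → ℕ → Prop
  | skip (s : State) : Runs w .skip s s 1
  | assign (s : State) (x : ℕ) (e : Expr) :
      Runs w (.assign x e) s ⟨Function.update s.var x (e.eval s), s.arr⟩ (e.cost + 1)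
  | store (s : State) (a : ℕ) (i e : Expr) :
      Runs w (.store a i e) s
        ⟨s.var, Function.update s.arr a (Function.update (s.arr a) (i.eval s) (e.eval s))⟩
        (i.cost + e.cost + 1)
  | seq {s s' s'' : State} {p q : Program} {t t' : ℕ} :
      Runs w p s s' t → Runs w q s' s'' t' → Runs w (.seq p q) s s'' (t + t')
  | branch_true {s s' : State} {b : Test} {p q : Program} {t : ℕ} :
      b.Holds w s → Runs w p s s' t → Runs w (.branch b p q) s s' (b.cost + t + 1)
  | branch_false {s s' : State} {b : Test} {p q : Program} {t : ℕ} :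
      ¬ b.Holds w s → Runs w q s s' t → Runs w (.branch b p q) s s' (b.cost + t + 1)
  | loop_false {s : State} {b : Test} {p : Program} :
      ¬ b.Holds w s → Runs w (.loop b p) s s (b.cost + 1)
  | loop_true {s s' s'' : State} {b : Test} {p : Program} {t t' : ℕ} :
      b.Holds w s → Runs w p s s' t → Runs w (.loop b p) s' s'' t' →
      Runs w (.loop b p) s s'' (b.cost + t + t' + 1)

/-- A vector of length `m` as a zero-padded array. -/
def ofFin {α : Type*} [Zero α] {m : ℕ} (f : Fin m → α) : ℕ → α :=
  fun i => if h : i < m then f ⟨i, h⟩ else 0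

/-- The initial state for a rooted digraph with nodes `0, …, n - 1` and edges `0, …, m - 1`:
variables 0, 1, 2 hold `n`, `m` and the root, arrays 0 and 1 hold the tails and the heads of the
edges, and everything else is zero. -/
def inputState {n m : ℕ} (D : RootedDigraph (Fin n) (Fin m)) : State where
  var := fun
    | 0 => n
    | 1 => m
    | 2 => D.root
    | _ => 0
  arr := fun
    | 0 => ofFin (fun e => (D.tail e : ℕ))
    | 1 => ofFin (fun e => (D.head e : ℕ))
    | _ => fun _ => 0

/-- The edge set that the state encodes: array 2 holds its characteristic vector. -/
def outputSet (m : ℕ) (s : State) : Finset (Fin m) :=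
  Finset.univ.filter (fun e => s.arr 2 e = 1)

end RAM

/-!
For a node `v` other than the root, call a set of edges into `v` *linkable* if it is the set of the
last edges of edge-disjoint paths from the root to `v`. By max-flow min-cut this is a condition on
cuts (`IsLinkable`), and the linkable sets are the independent sets of a matroid whose rank is the
local connectivity at `v`. In an acyclic digraph an edge set is a maximal flame if and only if, up
to edges into the root, it contains a base of this matroid for each `v` and no other edges. A
maximal flame of minimum weight is therefore found by a separate greedy algorithm at each node.

That a maximal flame consists of bases is immediate. The converse is
`card_inEdges_le_card_entering`: the tight sets left by the greedy algorithm are minimum cuts of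
the original digraph, and these are uncrossed with a given cut, by induction along a topological
order, until the cut loses no edge when the other edges are deleted. The matroid structure itself is
not needed: `IsGreedyState` records one tight set that contains the tails of all rejected edges,
and an inequality between the weight of the accepted set and that of any linkable set.

The greedy algorithm keeps a flow that avoids the edges into `v` and supplies the tails of the
accepted edges. The edge `e` can be accepted if and only if the flow can be augmented from the root
to the tail of `e` (`IsGreedyState.accept`, `IsGreedyState.reject`). Each edge is tested once, with
one breadth-first search in the residual graph. The search takes time `O(|E|)`, since all reached
nodes other than the root are ends of edges (`terminates_search`), and so do the selection of
the next edge in the order by head and weight and the augmentation itself. Edges are tested in the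
order of their heads, and a flow is stored by labels that name the head, so the flow need not be
cleared when the next node is taken up; likewise the reached nodes are labelled by the number of the
round. No step depends on the number of nodes, which `|E|` does not bound.

The running time is treated by a total correctness calculus (`Terminates`) in which each loop is
paid for by a potential (`Terminates.loop`), and programs without loops are simply evaluated
(`terminates_of_loopFree`).
-/

/-! ### Edge sets as flows, cuts and demands -/

namespace RootedDigraph

section Flow

variable {V E : Type*} [DecidableEq V] [DecidableEq E] (D : RootedDigraph V E)

/-- The net inflow at `u` of the `0`-`1` flow that is the characteristic vector of `x`. -/
def excess (x : Finset E) (u : V) : ℤ :=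
  ∑ e ∈ x, ((if D.head e = u then 1 else 0) - (if D.tail e = u then 1 else 0))

/-- The edges of `A` that enter the node set `T`. -/
def entering (A : Finset E) (T : Finset V) : Finset E :=
  A.filter fun e => D.tail e ∉ T ∧ D.head e ∈ T

/-- The edges of `A` with tail in `T`. For a set of edges into one node, each of them demands
one unit of flow at its tail, and this is the demand inside `T`. -/
def tailsIn (A : Finset E) (T : Finset V) : Finset E :=
  A.filter fun e => D.tail e ∈ T

omit [DecidableEq E] in
theorem sum_excess (x : Finset E) (T : Finset V) :
    ∑ u ∈ T, D.excess x u =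
      (D.entering x T).card - (x.filter fun e => D.tail e ∈ T ∧ D.head e ∉ T).card := by
  unfold excess entering
  rw [Finset.sum_comm, Finset.card_filter, Finset.card_filter]
  push_cast
  rw [← Finset.sum_sub_distrib]
  refine Finset.sum_congr rfl fun e _ => ?_
  rw [Finset.sum_sub_distrib, Finset.sum_ite_eq, Finset.sum_ite_eq]
  by_cases h1 : D.head e ∈ T <;> by_cases h2 : D.tail e ∈ T <;> simp [h1, h2]

omit [DecidableEq E] in
theorem sum_excess_le (x : Finset E) (T : Finset V) :
    ∑ u ∈ T, D.excess x u ≤ (D.entering x T).card := by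
  rw [sum_excess]; omega

omit [DecidableEq E] in
theorem card_entering_mono {A B : Finset E} (h : A ⊆ B) (T : Finset V) :
    (D.entering A T).card ≤ (D.entering B T).card :=
  Finset.card_le_card (Finset.filter_subset_filter _ h)

omit [DecidableEq E] in
theorem card_entering_union_add_inter (A : Finset E) (S T : Finset V) :
    (D.entering A (S ∪ T)).card + (D.entering A (S ∩ T)).card ≤
      (D.entering A S).card + (D.entering A T).card := by
  unfold entering
  simp only [Finset.card_filter, ← Finset.sum_add_distrib]
  refine Finset.sum_le_sum fun e _ => ?_
  by_cases h1 : D.head e ∈ S <;> by_cases h2 : D.tail e ∈ S <;>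
  by_cases h3 : D.head e ∈ T <;> by_cases h4 : D.tail e ∈ T <;> simp [h1, h2, h3, h4]

omit [DecidableEq E] in
theorem card_tailsIn_union_add_inter (A : Finset E) (S T : Finset V) :
    (D.tailsIn A (S ∪ T)).card + (D.tailsIn A (S ∩ T)).card =
      (D.tailsIn A S).card + (D.tailsIn A T).card := by
  unfold tailsIn
  simp only [Finset.card_filter, ← Finset.sum_add_distrib]
  refine Finset.sum_congr rfl fun e _ => ?_
  by_cases h2 : D.tail e ∈ S <;> by_cases h4 : D.tail e ∈ T <;> simp [h2, h4]

omit [DecidableEq E] in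
theorem card_tailsIn_eq_sum (A : Finset E) (T : Finset V) :
    (D.tailsIn A T).card = ∑ u ∈ T, (A.filter fun e => D.tail e = u).card := by
  unfold tailsIn
  simp only [Finset.card_filter]
  rw [Finset.sum_comm]
  exact Finset.sum_congr rfl fun e _ => by rw [Finset.sum_ite_eq]

theorem excess_insert {x : Finset E} {e : E} (he : e ∉ x) (u : V) :
    D.excess (insert e x) u = D.excess x u +
      ((if D.head e = u then 1 else 0) - (if D.tail e = u then 1 else 0)) := by
  rw [excess, Finset.sum_insert he, add_comm]; rfl

theorem excess_erase {x : Finset E} {e : E} (he : e ∈ x) (u : V) :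
    D.excess (x.erase e) u = D.excess x u -
      ((if D.head e = u then 1 else 0) - (if D.tail e = u then 1 else 0)) := by
  have := D.excess_insert (Finset.notMem_erase e x) u
  rw [Finset.insert_erase he] at this
  omega

theorem excess_union {x y : Finset E} (h : Disjoint x y) (u : V) :
    D.excess (x ∪ y) u = D.excess x u + D.excess y u := by
  unfold excess; rw [Finset.sum_union h]

/-! ### Residual graphs and augmentation -/

/-- The start of the arc that `e` contributes to the residual graph of the flow `x`: edges of `x`
are reversed there. -/
def arcTail (x : Finset E) (e : E) : V := if e ∈ x then D.head e else D.tail e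

/-- The end of the arc that `e` contributes to the residual graph of the flow `x`. -/
def arcHead (x : Finset E) (e : E) : V := if e ∈ x then D.tail e else D.head e

/-- `R` is a set of nodes reached from the root in the residual graph of the flow `x` inside `A`:
every other node of `R` is the end of a residual arc from a node of `R` with smaller `pos`. -/
def IsSearchTree (A x : Finset E) (R : Finset V) (pos : V → ℕ) : Prop :=
  ∀ u ∈ R, u ≠ D.root →
    ∃ e ∈ A, D.arcHead x e = u ∧ D.arcTail x e ∈ R ∧ pos (D.arcTail x e) < pos u

/-- `X` arises from the flow `x` by augmentation along the part from `y` to `t` of a path in a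
search tree. The edges whose residual arc ends no later than `y` are still in their old state. -/
structure IsPartialAugment (x X : Finset E) (pos : V → ℕ) (t y : V) : Prop where
  agree : ∀ e, (e ∈ X ↔ e ∈ x) ∨ pos y < pos (D.arcHead x e)
  excess_eq : ∀ u, D.excess X u =
    D.excess x u + (if t = u then 1 else 0) - (if y = u then 1 else 0)

theorem IsPartialAugment.refl (x : Finset E) (pos : V → ℕ) (t : V) :
    D.IsPartialAugment x x pos t t :=
  ⟨fun _ => Or.inl Iff.rfl, fun _ => by ring⟩

variable {D}

theorem IsPartialAugment.mem_iff {x X : Finset E} {pos : V → ℕ} {t : V} {e : E}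
    (h : D.IsPartialAugment x X pos t (D.arcHead x e)) : e ∈ X ↔ e ∈ x :=
  (h.agree e).resolve_right (lt_irrefl _)

/-- One step of the augmentation: the residual arc that ends at the current node is switched. -/
theorem IsPartialAugment.step {x X : Finset E} {pos : V → ℕ} {t : V} {e : E}
    (h : D.IsPartialAugment x X pos t (D.arcHead x e))
    (hpos : pos (D.arcTail x e) < pos (D.arcHead x e)) :
    D.IsPartialAugment x (if e ∈ x then X.erase e else insert e X) pos t (D.arcTail x e) := by
  have hmem := h.mem_iff
  constructor
  · intro f
    by_cases hfe : f = e
    · subst hfe; exact Or.inr hpos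
    · rcases h.agree f with h1 | h1
      · left
        split_ifs <;> simp [hfe, h1]
      · exact Or.inr (hpos.trans h1)
  · intro u
    have := h.excess_eq u
    by_cases hx : e ∈ x
    · simp only [arcTail, arcHead, if_pos hx] at this ⊢
      rw [D.excess_erase (hmem.2 hx), this]; ring
    · simp only [arcTail, arcHead, if_neg hx] at this ⊢
      rw [D.excess_insert (fun h => hx (hmem.1 h)), this]; ring

theorem IsPartialAugment.exists_root {A x : Finset E} {S : Finset V} {pos : V → ℕ} {t : V}
    (htree : D.IsSearchTree A x S pos) (n : ℕ) :
    ∀ (y : V) (X : Finset E), pos y = n → y ∈ S → X ⊆ A → D.IsPartialAugment x X pos t y →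
      ∃ X' ⊆ A, D.IsPartialAugment x X' pos t D.root := by
  induction n using Nat.strong_induction_on with
  | _ n ih =>
    intro y X hn hy hXA hX
    by_cases hyr : y = D.root
    · subst hyr; exact ⟨X, hXA, hX⟩
    · obtain ⟨e, heA, rfl, hS, hpos⟩ := htree y hy hyr
      refine ih _ (hn ▸ hpos) _ _ rfl hS ?_ (hX.step hpos)
      split_ifs
      · exact (Finset.erase_subset _ _).trans hXA
      · exact Finset.insert_subset heA hXA

/-- A set of nodes that contains the root and that no residual arc leaves has a complement whose
entering edges all carry flow, and no flow leaves it. -/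
theorem card_entering_compl_of_closed [Fintype V] {A x : Finset E} {R : Finset V} (hx : x ⊆ A)
    (hR : ∀ e ∈ A, D.arcTail x e ∈ R → D.arcHead x e ∈ R) :
    ((D.entering A Rᶜ).card : ℤ) = ∑ u ∈ Rᶜ, D.excess x u := by
  have h1 : D.entering A Rᶜ = D.entering x Rᶜ := by
    ext e
    simp only [entering, Finset.mem_filter, Finset.mem_compl, not_not]
    constructor
    · rintro ⟨heA, ht, hh⟩
      refine ⟨by_contra fun hex => hh ?_, ht, hh⟩
      have := hR e heA
      simp only [arcTail, arcHead, if_neg hex] at this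
      exact this ht
    · rintro ⟨hex, h⟩
      exact ⟨hx hex, h⟩
  have h2 : (x.filter fun e => D.tail e ∈ Rᶜ ∧ D.head e ∉ Rᶜ) = ∅ := by
    refine Finset.filter_eq_empty_iff.2 fun {e} hex => ?_
    rintro ⟨ht, hh⟩
    have := hR e (hx hex)
    simp only [arcTail, arcHead, if_pos hex] at this
    simp only [Finset.mem_compl, not_not] at ht hh
    exact ht (this hh)
  rw [sum_excess, h1, h2]; simp

variable (D)

/-- Either one more unit of flow can be sent from the root to `t`, or the residual graph has a
closed node set that contains the root but not `t`. -/
theorem exists_augment_or_closed [Fintype V] {A x : Finset E} (hx : x ⊆ A) (t : V) :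
    (∃ X ⊆ A, ∀ u, D.excess X u =
        D.excess x u + (if t = u then 1 else 0) - (if D.root = u then 1 else 0)) ∨
      ∃ R : Finset V, D.root ∈ R ∧ t ∉ R ∧
        ∀ e ∈ A, D.arcTail x e ∈ R → D.arcHead x e ∈ R := by
  classical
  -- `S k` is the set of the nodes at residual distance at most `k` from the root.
  let next : Finset V → Finset V := fun s =>
    s ∪ (A.filter fun e => D.arcTail x e ∈ s).image (D.arcHead x)
  let S : ℕ → Finset V := fun k => next^[k] {D.root}
  have hS0 : S 0 = {D.root} := rfl
  have hS : ∀ k, S (k + 1) = next (S k) := fun k => Function.iterate_succ_apply' next k _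
  let R : Finset V := Finset.univ.filter fun u => ∃ k, u ∈ S k
  have hmemR : ∀ u, u ∈ R ↔ ∃ k, u ∈ S k := fun u => by simp [R]
  by_cases ht : t ∈ R
  · left
    let pos : V → ℕ := fun u => if h : ∃ k, u ∈ S k then Nat.find h else 0
    have htree : D.IsSearchTree A x R pos := by
      intro u hu hur
      have hk := (hmemR u).1 hu
      have hpos : pos u = Nat.find hk := dif_pos hk
      have hfind := Nat.find_spec hk
      rcases hj : Nat.find hk with _ | j
      · rw [hj, hS0] at hfind
        exact absurd (Finset.mem_singleton.1 hfind) hur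
      · rw [hj, hS] at hfind
        have hnot : u ∉ S j := Nat.find_min hk (by omega)
        have := (Finset.mem_union.1 hfind).resolve_left hnot
        obtain ⟨e, he, rfl⟩ := Finset.mem_image.1 this
        obtain ⟨heA, heS⟩ : e ∈ A ∧ D.arcTail x e ∈ S j := by simpa using he
        refine ⟨e, heA, rfl, (hmemR _).2 ⟨j, heS⟩, ?_⟩
        have h2 : ∃ k, D.arcTail x e ∈ S k := ⟨j, heS⟩
        have : pos (D.arcTail x e) = Nat.find h2 := dif_pos h2
        rw [this, hpos, hj]
        exact Nat.lt_succ_of_le (Nat.find_min' h2 heS)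
    obtain ⟨X, hXA, hX⟩ := IsPartialAugment.exists_root htree _ t x rfl ht hx
      (IsPartialAugment.refl D x pos t)
    exact ⟨X, hXA, hX.excess_eq⟩
  · refine Or.inr ⟨R, (hmemR _).2 ⟨0, by simp [hS0]⟩, ht, fun e he het => ?_⟩
    obtain ⟨k, hk⟩ := (hmemR _).1 het
    refine (hmemR _).2 ⟨k + 1, ?_⟩
    rw [hS]
    refine Finset.mem_union_right _ (Finset.mem_image_of_mem _ ?_)
    simpa using ⟨he, hk⟩

/-! ### Disjoint paths and flows -/

/-- There is a flow of value `k` from the root to `v` inside `F`. -/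
def HasFlow (F : Finset E) (v : V) (k : ℕ) : Prop :=
  ∃ X ⊆ F, ∀ u, u ≠ D.root → D.excess X u = if u = v then (k : ℤ) else 0

variable {D}

omit [DecidableEq E] in
theorem HasFlow.le_card_entering {F : Finset E} {v : V} {k : ℕ} (h : D.HasFlow F v k)
    {T : Finset V} (hv : v ∈ T) (hr : D.root ∉ T) : k ≤ (D.entering F T).card := by
  obtain ⟨X, hX, hex⟩ := h
  have h1 := D.sum_excess_le X T
  have h2 : ∑ u ∈ T, D.excess X u = k := by
    rw [Finset.sum_congr rfl fun u hu => hex u fun h => hr (h ▸ hu), Finset.sum_ite_eq', if_pos hv]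
  have h3 := D.card_entering_mono hX T
  omega

omit [DecidableEq E] in
theorem HasFlow.mono {F G : Finset E} {v : V} {k : ℕ} (h : D.HasFlow F v k) (hFG : F ⊆ G) :
    D.HasFlow G v k :=
  let ⟨X, hX, hex⟩ := h
  ⟨X, hX.trans hFG, hex⟩

/-- Max-flow min-cut: a flow of value `k` exists if each cut has at least `k` edges. -/
theorem hasFlow_of_forall_le_card_entering [Fintype V] {F : Finset E} {v : V} (hv : v ≠ D.root)
    (k : ℕ) (h : ∀ T : Finset V, v ∈ T → D.root ∉ T → k ≤ (D.entering F T).card) :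
    D.HasFlow F v k := by
  induction k with
  | zero => exact ⟨∅, by simp, fun u _ => by simp [excess]⟩
  | succ k ih =>
    obtain ⟨X, hX, hex⟩ := ih fun T h1 h2 => (Nat.le_succ k).trans (h T h1 h2)
    rcases D.exists_augment_or_closed hX v with ⟨Y, hY, hYex⟩ | ⟨R, hr, hvR, hR⟩
    · refine ⟨Y, hY, fun u hu => ?_⟩
      rw [hYex, hex u hu, if_neg hu.symm]
      by_cases huv : u = v
      · subst huv; simp
      · simp [huv, Ne.symm huv]
    · have h1 := card_entering_compl_of_closed hX hR
      have h2 := h Rᶜ (by simpa using hvR) (by simpa using hr)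
      have h3 : ∑ u ∈ Rᶜ, D.excess X u = k := by
        rw [Finset.sum_congr rfl fun u hu => hex u fun h => ?_, Finset.sum_ite_eq',
          if_pos (by simpa using hvR)]
        subst h; simp [hr] at hu
      omega

end Flow

section Walk

variable {V E : Type*} {D : RootedDigraph V E}

theorem IsWalk.concat {u : V} {e : E} {p : List E} (h : D.IsWalk u (D.tail e) p) :
    D.IsWalk u (D.head e) (p ++ [e]) := by
  induction p generalizing u with
  | nil => exact ⟨h.symm, rfl⟩
  | cons f p ih => exact ⟨h.1, ih h.2⟩

theorem IsWalk.exists_prefix {u v z : V} {p : List E} (h : D.IsWalk u v p)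
    (hz : z ∈ p.map D.head) : ∃ q, q ≠ [] ∧ D.IsWalk u z q := by
  induction p generalizing u with
  | nil => simp at hz
  | cons f p ih =>
    rw [List.map_cons, List.mem_cons] at hz
    rcases hz with rfl | hz
    · exact ⟨[f], by simp, h.1, rfl⟩
    · obtain ⟨q, _, hq⟩ := ih h.2 hz
      exact ⟨f :: q, by simp, h.1, hq⟩

theorem IsWalk.isPath (hD : D.Acyclic) {u v : V} {p : List E} (h : D.IsWalk u v p) :
    D.IsPath u v p := by
  refine ⟨h, ?_⟩
  induction p generalizing u with
  | nil => simp
  | cons f p ih =>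
    refine List.nodup_cons.2 ⟨fun hu => ?_, ih h.2⟩
    obtain ⟨q, hq, hw⟩ := h.exists_prefix hu
    exact hD u q hq hw

theorem Acyclic.exists_topological_order [Fintype V] (hD : D.Acyclic) :
    ∃ ord : V → ℕ, ∀ e, ord (D.tail e) < ord (D.head e) := by
  classical
  -- The number of nodes from which `v` can be reached.
  refine ⟨fun v => (Finset.univ.filter fun u => ∃ p, D.IsWalk u v p).card, fun e => ?_⟩
  refine Finset.card_lt_card ((Finset.ssubset_iff_of_subset fun u hu => ?_).2 ⟨D.head e, ?_, ?_⟩)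
  · simp only [Finset.mem_filter, Finset.mem_univ, true_and] at hu ⊢
    obtain ⟨p, hp⟩ := hu
    exact ⟨_, hp.concat⟩
  · simpa using ⟨[], rfl⟩
  · simp only [Finset.mem_filter, Finset.mem_univ, true_and]
    rintro ⟨p, hp⟩
    exact hD _ _ (by simp) hp.concat

variable [DecidableEq V]

theorem IsWalk.sum_map {u v : V} {p : List E} (h : D.IsWalk u v p) (z : V) :
    (p.map fun e => ((if D.head e = z then 1 else 0) - (if D.tail e = z then 1 else 0) : ℤ)).sum =
      (if v = z then 1 else 0) - (if u = z then 1 else 0) := by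
  induction p generalizing u with
  | nil => obtain rfl : u = v := h; simp
  | cons f p ih =>
    obtain ⟨rfl, h2⟩ := h
    rw [List.map_cons, List.sum_cons, ih h2]; ring

variable [DecidableEq E]

theorem IsPath.excess {u v : V} {p : List E} (h : D.IsPath u v p) (z : V) :
    D.excess p.toFinset z = (if v = z then 1 else 0) - (if u = z then 1 else 0) := by
  rw [← h.1.sum_map z, RootedDigraph.excess,
    List.sum_toFinset _ (List.Nodup.of_map _ (List.nodup_cons.1 h.2).2)]

theorem HasDisjointPaths.hasFlow {F : Finset E} {v : V} {k : ℕ}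
    (h : D.HasDisjointPaths F v k) : D.HasFlow F v k := by
  obtain ⟨P, hP, hdisj⟩ := h
  refine ⟨Finset.univ.biUnion fun i => (P i).toFinset, fun e he => ?_, fun u hu => ?_⟩
  · obtain ⟨i, -, hi⟩ := Finset.mem_biUnion.1 he
    exact (hP i).2 e (List.mem_toFinset.1 hi)
  · have : D.excess (Finset.univ.biUnion fun i => (P i).toFinset) u =
        ∑ i, D.excess (P i).toFinset u := by
      refine Finset.sum_biUnion fun i _ j _ hij => ?_
      rw [Function.onFun, List.disjoint_toFinset_iff_disjoint]
      exact hdisj i j hij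
    rw [this, Finset.sum_congr rfl fun i _ => (hP i).1.excess u]
    simp [hu.symm, eq_comm]

omit [DecidableEq E] in
/-- A flow from the root to `v` of positive value contains a walk: otherwise the nodes that cannot
be reached would receive nothing. -/
theorem exists_walk_of_excess [Fintype V] {X : Finset E} {v : V}
    (hX : ∀ u, u ≠ D.root → 0 ≤ D.excess X u) (hXv : 0 < D.excess X v) :
    ∃ p, D.IsWalk D.root v p ∧ ∀ e ∈ p, e ∈ X := by
  classical
  by_contra hcon
  let T : Finset V := Finset.univ.filter fun u => ¬ ∃ p, D.IsWalk D.root u p ∧ ∀ e ∈ p, e ∈ X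
  have hT : ∀ u, u ∈ T ↔ ¬ ∃ p, D.IsWalk D.root u p ∧ ∀ e ∈ p, e ∈ X := fun u => by simp [T]
  have hroot : ∀ u ∈ T, u ≠ D.root := by
    rintro u hu rfl
    exact (hT _).1 hu ⟨[], rfl, by simp⟩
  have h1 : 0 < ∑ u ∈ T, D.excess X u :=
    Finset.sum_pos' (fun u hu => hX u (hroot u hu)) ⟨v, (hT v).2 hcon, hXv⟩
  have h2 : D.entering X T = ∅ := by
    refine Finset.filter_eq_empty_iff.2 fun {e} he => ?_
    rintro ⟨h3, h4⟩
    rw [hT, not_not] at h3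
    obtain ⟨p, hp, hpX⟩ := h3
    refine (hT _).1 h4 ⟨p ++ [e], hp.concat, fun f hf => ?_⟩
    rcases List.mem_append.1 hf with hf | hf
    · exact hpX f hf
    · rwa [List.mem_singleton.1 hf]
  have h3 := D.sum_excess_le X T
  rw [h2] at h3
  simp at h3
  omega

theorem HasFlow.hasDisjointPaths [Fintype V] (hD : D.Acyclic) {F : Finset E} {v : V} {k : ℕ}
    (hv : v ≠ D.root) (h : D.HasFlow F v k) : D.HasDisjointPaths F v k := by
  induction k generalizing F with
  | zero => exact ⟨fun i => i.elim0, fun i => i.elim0, fun i => i.elim0⟩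
  | succ k ih =>
    obtain ⟨X, hXF, hex⟩ := h
    obtain ⟨p, hp, hpX⟩ := exists_walk_of_excess (X := X)
      (fun u hu => by rw [hex u hu]; split_ifs <;> positivity)
      (by rw [hex v hv, if_pos rfl]; positivity)
    have hpath := hp.isPath hD
    obtain ⟨P, hP, hdisj⟩ := ih (F := X \ p.toFinset) ⟨X \ p.toFinset, subset_rfl, fun u hu => by
      have h1 := D.excess_union (Finset.disjoint_sdiff (s := p.toFinset) (t := X)) u
      rw [Finset.union_sdiff_of_subset fun e he => hpX e (List.mem_toFinset.1 he),
        hpath.excess, hex u hu, if_neg hu.symm] at h1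
      by_cases huv : u = v
      · subst huv
        simp at h1 ⊢
        omega
      · simp [huv, Ne.symm huv] at h1 ⊢
        omega⟩
    have hPp : ∀ i, List.Disjoint p (P i) := fun i e he he' => by
      have := (hP i).2 e he'
      simp [he] at this
    refine ⟨Fin.cons p P, fun i => ?_, fun i j hij => ?_⟩
    · refine Fin.cases ?_ (fun i => ?_) i
      · exact ⟨hpath, fun e he => hXF (hpX e he)⟩
      · exact ⟨(hP i).1, fun e he => hXF (Finset.mem_sdiff.1 ((hP i).2 e he)).1⟩
    · induction i using Fin.cases <;> induction j using Fin.cases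
      · exact absurd rfl hij
      · simpa using hPp _
      · simpa using (hPp _).symm
      · simpa using hdisj _ _ fun h => hij (by rw [h])

theorem hasDisjointPaths_iff_hasFlow [Fintype V] (hD : D.Acyclic) {F : Finset E} {v : V}
    (hv : v ≠ D.root) (k : ℕ) : D.HasDisjointPaths F v k ↔ D.HasFlow F v k :=
  ⟨fun h => h.hasFlow, fun h => h.hasDisjointPaths hD hv⟩

theorem localConn_eq [Fintype V] (hD : D.Acyclic) {F : Finset E} {v : V} (hv : v ≠ D.root)
    {k : ℕ} (h : D.HasFlow F v k) (hmax : ∀ l, D.HasFlow F v l → l ≤ k) :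
    D.localConn F v = k :=
  IsGreatest.csSup_eq ⟨(hasDisjointPaths_iff_hasFlow hD hv k).2 h,
    fun l hl => hmax l ((hasDisjointPaths_iff_hasFlow hD hv l).1 hl)⟩

theorem hasFlow_localConn (F : Finset E) {v : V}
    (hv : v ≠ D.root) : D.HasFlow F v (D.localConn F v) := by
  have hne : {k | D.HasDisjointPaths F v k}.Nonempty :=
    ⟨0, fun i => i.elim0, fun i => i.elim0, fun i => i.elim0⟩
  exact HasDisjointPaths.hasFlow (Nat.sSup_mem hne (bddAbove_hasDisjointPaths D F v hv))

end Walk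

end RootedDigraph

/-! ### The greedy choice of the edges entering one node -/

namespace RootedDigraph

section Greedy

variable {V E : Type*} [DecidableEq V] [DecidableEq E] [Fintype E] (D : RootedDigraph V E)

/-- The edges that do not enter `v`. -/
def avoiding (v : V) : Finset E := Finset.univ.filter fun e => D.head e ≠ v

/-- The edges of `A` that enter `v`. -/
def inEdges (A : Finset E) (v : V) : Finset E := A.filter fun e => D.head e = v

/-- The cut condition for edge-disjoint paths from the root whose last edges are the edges of `J`,
where `J` is a set of edges into `v`. -/
def IsLinkable (v : V) (J : Finset E) : Prop :=
  ∀ T : Finset V, D.root ∉ T → (D.tailsIn J T).card ≤ (D.entering (D.avoiding v) T).card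

/-- `x` is a flow that avoids the edges into `v` and supplies the tails of the edges of `I`. -/
structure Supplies (v : V) (I x : Finset E) : Prop where
  subset : x ⊆ D.avoiding v
  excess_eq : ∀ u, u ≠ D.root → D.excess x u = (I.filter fun e => D.tail e = u).card

/-- The state of the greedy algorithm that selects a minimum weight base among the edges into `v`:
the edges of `P` have been processed, those of `I` have been accepted, and the flow `x` links
them to the root. All rejected edges start in one node set whose entering edges are used up by the
accepted ones, and `I` is as good as every linkable set `J`, even if `J ∩ P` is filled up to the
size of `I` by elements of any weight `c` that is at least as large as the weights in `P`. -/
structure IsGreedyState (w : E → ℚ≥0) (v : V) (P I x : Finset E) : Prop where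
  subset : I ⊆ P
  supplies : D.Supplies v I x
  tight : ∃ T : Finset V, D.root ∉ T ∧ (∀ e ∈ P, e ∉ I → D.tail e ∈ T) ∧
    (D.entering (D.avoiding v) T).card ≤ (D.tailsIn I T).card
  weight : ∀ J, D.IsLinkable v J → ∀ c, (∀ e ∈ P, w e ≤ c) →
    ∑ e ∈ I, w e + (J ∩ P).card * c ≤ ∑ e ∈ J ∩ P, w e + I.card * c

variable {D} {w : E → ℚ≥0} {v : V}

omit [DecidableEq E] in
theorem Supplies.sum_excess {I x : Finset E} (h : D.Supplies v I x) {T : Finset V}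
    (hT : D.root ∉ T) : ∑ u ∈ T, D.excess x u = (D.tailsIn I T).card := by
  rw [card_tailsIn_eq_sum, Nat.cast_sum]
  exact Finset.sum_congr rfl fun u hu => h.excess_eq u fun h => hT (h ▸ hu)

omit [DecidableEq E] in
theorem Supplies.isLinkable {I x : Finset E} (h : D.Supplies v I x) : D.IsLinkable v I := by
  intro T hT
  have h1 := h.sum_excess hT
  have h2 := D.sum_excess_le x T
  have h3 := D.card_entering_mono h.subset T
  omega

theorem IsGreedyState.empty (D : RootedDigraph V E) (w : E → ℚ≥0) (v : V) :
    D.IsGreedyState w v ∅ ∅ ∅ where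
  subset := subset_rfl
  supplies := ⟨by simp, by simp [excess]⟩
  tight := ⟨∅, by simp, by simp, by simp [entering]⟩
  weight := by simp

/-- A tight set that contains the tails of the rejected edges bounds the number of processed
edges in a linkable set. -/
theorem card_inter_le_of_tight {P I J : Finset E} (hJ : D.IsLinkable v J) {T : Finset V}
    (hT : D.root ∉ T) (hP : ∀ e ∈ P, e ∉ I → D.tail e ∈ T)
    (hcard : (D.entering (D.avoiding v) T).card ≤ (D.tailsIn I T).card) :
    (J ∩ P).card ≤ I.card := by
  have h1 := hJ T hT
  have h2 : ∀ A : Finset E, A.card = (D.tailsIn A T).card + (A \ D.tailsIn A T).card := fun A => by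
    have := Finset.card_sdiff_add_card_eq_card (Finset.filter_subset (fun e => D.tail e ∈ T) A)
    unfold tailsIn
    omega
  have h3 : (D.tailsIn (J ∩ P) T).card ≤ (D.tailsIn J T).card :=
    Finset.card_le_card (Finset.filter_subset_filter _ Finset.inter_subset_left)
  have h4 : ((J ∩ P) \ D.tailsIn (J ∩ P) T).card ≤ (I \ D.tailsIn I T).card := by
    refine Finset.card_le_card fun e he => ?_
    simp only [tailsIn, Finset.mem_sdiff, Finset.mem_filter, Finset.mem_inter] at he ⊢
    have htail : D.tail e ∉ T := fun h => he.2 ⟨he.1, h⟩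
    exact ⟨by_contra fun h => htail (hP e he.1.2 h), fun h => htail h.2⟩
  rw [h2 (J ∩ P), h2 I]
  omega

theorem IsGreedyState.accept {P I x X : Finset E} {e : E} (h : D.IsGreedyState w v P I x)
    (heP : e ∉ P) (hX : X ⊆ D.avoiding v)
    (hex : ∀ u, D.excess X u =
      D.excess x u + (if D.tail e = u then 1 else 0) - (if D.root = u then 1 else 0)) :
    D.IsGreedyState w v (insert e P) (insert e I) X := by
  have heI : e ∉ I := fun h' => heP (h.subset h')
  have hsup : D.Supplies v (insert e I) X := by
    refine ⟨hX, fun u hu => ?_⟩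
    rw [hex, h.supplies.excess_eq u hu, Finset.filter_insert, if_neg hu.symm]
    split_ifs with hu'
    · rw [Finset.card_insert_of_notMem (fun h' => heI (Finset.mem_filter.1 h').1)]
      push_cast; ring
    · ring
  refine ⟨Finset.insert_subset_insert _ h.subset, hsup, ?_, ?_⟩
  · obtain ⟨T, hT, hrej, hcard⟩ := h.tight
    refine ⟨T, hT, fun d hd hd' => ?_, hcard.trans ?_⟩
    · rw [Finset.mem_insert, not_or] at hd'
      exact hrej d ((Finset.mem_insert.1 hd).resolve_left hd'.1) hd'.2
    · exact Finset.card_le_card (Finset.filter_subset_filter _ (Finset.subset_insert _ _))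
  · intro J hJ c hc
    have h1 := h.weight J hJ c fun d hd => hc d (Finset.mem_insert_of_mem hd)
    have h2 := hc e (Finset.mem_insert_self _ _)
    rw [Finset.sum_insert heI, Finset.card_insert_of_notMem heI]
    by_cases heJ : e ∈ J
    · have h3 : e ∉ J ∩ P := fun h' => heP (Finset.mem_inter.1 h').2
      rw [Finset.inter_insert_of_mem heJ, Finset.sum_insert h3, Finset.card_insert_of_notMem h3]
      rw [← NNRat.coe_le_coe] at h1 h2 ⊢
      push_cast at h1 h2 ⊢
      linarith
    · rw [Finset.inter_insert_of_notMem heJ]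
      rw [← NNRat.coe_le_coe] at h1 h2 ⊢
      push_cast at h1 h2 ⊢
      linarith

/-- If the search from the root ends in a closed set without the tail of `e`, then `e` can be
rejected: the complement is tight, and so is its union with the former tight set. -/
theorem IsGreedyState.reject [Fintype V] {P I x : Finset E} {e : E} (h : D.IsGreedyState w v P I x)
    (heP : e ∉ P) (hw : ∀ d ∈ P, w d ≤ w e) {R : Finset V} (hroot : D.root ∈ R)
    (hte : D.tail e ∉ R)
    (hR : ∀ f ∈ D.avoiding v, D.arcTail x f ∈ R → D.arcHead x f ∈ R) :
    D.IsGreedyState w v (insert e P) I x := by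
  have htight : ∃ T : Finset V, D.root ∉ T ∧ (∀ d ∈ insert e P, d ∉ I → D.tail d ∈ T) ∧
      (D.entering (D.avoiding v) T).card ≤ (D.tailsIn I T).card := by
    obtain ⟨T, hT, hrej, hcard⟩ := h.tight
    have hrc : D.root ∉ Rᶜ := by simpa using hroot
    have hRc := card_entering_compl_of_closed h.supplies.subset hR
    rw [h.supplies.sum_excess hrc] at hRc
    refine ⟨T ∪ Rᶜ, ?_, fun d hd hdI => ?_, ?_⟩
    · rw [Finset.mem_union, not_or]; exact ⟨hT, hrc⟩
    · rcases Finset.mem_insert.1 hd with rfl | hd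
      · exact Finset.mem_union_right _ (by simpa using hte)
      · exact Finset.mem_union_left _ (hrej d hd hdI)
    · have h1 := D.card_entering_union_add_inter (D.avoiding v) T Rᶜ
      have h2 := D.card_tailsIn_union_add_inter I T Rᶜ
      have h3 := h.supplies.isLinkable (T ∩ Rᶜ) fun h' => hT (Finset.mem_inter.1 h').1
      omega
  refine ⟨h.subset.trans (Finset.subset_insert _ _), h.supplies, htight, ?_⟩
  intro J hJ c hc
  by_cases heJ : e ∈ J
  · obtain ⟨T, hT, hrej, hcard⟩ := htight
    have hle := card_inter_le_of_tight hJ hT hrej hcard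
    have h1 := h.weight J hJ (w e) hw
    have h2 := hc e (Finset.mem_insert_self _ _)
    have h3 : e ∉ J ∩ P := fun h' => heP (Finset.mem_inter.1 h').2
    rw [Finset.inter_insert_of_mem heJ, Finset.card_insert_of_notMem h3] at hle ⊢
    rw [Finset.sum_insert h3]
    obtain ⟨k, hk⟩ := Nat.exists_eq_add_of_le hle
    rw [hk] at h1 ⊢
    rw [← NNRat.coe_le_coe] at h1 h2 ⊢
    push_cast at h1 h2 ⊢
    have h4 : (k : ℚ) * w e ≤ k * c := mul_le_mul_of_nonneg_left h2 k.cast_nonneg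
    linarith
  · rw [Finset.inter_insert_of_notMem heJ]
    exact h.weight J hJ c fun d hd => hc d (Finset.mem_insert_of_mem hd)

/-! ### The accepted edges form a maximal flame of minimum weight -/

/-- When all edges into `v` have been processed, the tight set together with `v` is a minimum
cut between the root and `v`, and it contains the tails of all rejected edges. -/
theorem IsGreedyState.exists_minCut {I x : Finset E} (hv : v ≠ D.root)
    (h : D.IsGreedyState w v (D.inEdges Finset.univ v) I x) :
    ∃ C : Finset V, v ∈ C ∧ D.root ∉ C ∧ (∀ e, D.head e = v → e ∉ I → D.tail e ∈ C) ∧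
      (D.entering Finset.univ C).card ≤ I.card := by
  obtain ⟨T, hT, hrej, hcard⟩ := h.tight
  refine ⟨insert v T, Finset.mem_insert_self _ _, ?_, fun e he heI => ?_, ?_⟩
  · rw [Finset.mem_insert, not_or]; exact ⟨hv.symm, hT⟩
  · exact Finset.mem_insert_of_mem (hrej e (by simp [inEdges, he]) heI)
  · have h1 : D.entering Finset.univ (insert v T) ⊆
        D.entering (D.avoiding v) T ∪ (I \ D.tailsIn I T) := by
      intro e he
      simp only [entering, avoiding, tailsIn, Finset.mem_filter, Finset.mem_univ, true_and,
        Finset.mem_insert, not_or, Finset.mem_union, Finset.mem_sdiff] at he ⊢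
      by_cases hev : D.head e = v
      · right
        refine ⟨by_contra fun heI => he.1.2 (hrej e (by simp [inEdges, hev]) heI), ?_⟩
        exact fun h' => he.1.2 h'.2
      · exact Or.inl ⟨hev, he.1.2, he.2.resolve_left hev⟩
    have h2 := (Finset.card_le_card h1).trans (Finset.card_union_le _ _)
    have h3 := Finset.card_sdiff_add_card_eq_card (Finset.filter_subset (fun e => D.tail e ∈ T) I)
    unfold tailsIn at h2 hcard
    omega

omit [DecidableEq E] [Fintype E] in
theorem excess_of_forall_head_eq {I : Finset E} (hI : ∀ e ∈ I, D.head e = v) (u : V) :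
    D.excess I u =
      (if u = v then (I.card : ℤ) else 0) - (I.filter fun e => D.tail e = u).card := by
  rw [excess, Finset.sum_sub_distrib, Finset.card_filter]
  push_cast
  congr 1
  rw [Finset.sum_congr rfl fun e he => if_congr (by rw [hI e he]) rfl rfl]
  by_cases huv : u = v
  · subst huv; simp
  · simp [huv, Ne.symm huv]

theorem IsGreedyState.hasFlow {I x : Finset E}
    (h : D.IsGreedyState w v (D.inEdges Finset.univ v) I x) :
    D.HasFlow Finset.univ v I.card := by
  have hI : ∀ e ∈ I, D.head e = v := fun e he => by simpa [inEdges] using h.subset he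
  have hdisj : Disjoint x I := by
    refine Finset.disjoint_left.2 fun e hex heI => ?_
    have := h.supplies.subset hex
    simp [avoiding, hI e heI] at this
  refine ⟨x ∪ I, Finset.subset_univ _, fun u hu => ?_⟩
  rw [D.excess_union hdisj, h.supplies.excess_eq u hu, excess_of_forall_head_eq hI]
  ring

/-- The last edges of edge-disjoint paths to `v` form a linkable set. -/
theorem isLinkable_of_hasFlow {F : Finset E} (hv : v ≠ D.root)
    (h : D.HasFlow F v (D.inEdges F v).card) : D.IsLinkable v (D.inEdges F v) := by
  obtain ⟨X, hXF, hex⟩ := h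
  have hsub : D.inEdges X v ⊆ D.inEdges F v := Finset.filter_subset_filter _ hXF
  have hv' := hex v hv
  rw [if_pos rfl, excess, Finset.sum_sub_distrib] at hv'
  -- The value of the flow leaves no room for edges of `X` that start in `v`.
  have h1 : ∑ e ∈ X, (if D.head e = v then (1 : ℤ) else 0) = (D.inEdges X v).card := by
    rw [inEdges, Finset.card_filter]; push_cast; rfl
  have h2 : ∑ e ∈ X, (if D.tail e = v then (1 : ℤ) else 0) =
      (X.filter fun e => D.tail e = v).card := by
    rw [Finset.card_filter]; push_cast; rfl
  have h3 := Finset.card_le_card hsub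
  have heq : D.inEdges X v = D.inEdges F v := Finset.eq_of_subset_of_card_le hsub (by omega)
  rw [← heq]
  have hunion : X \ D.inEdges X v ∪ D.inEdges X v = X :=
    Finset.sdiff_union_of_subset (Finset.filter_subset _ _)
  refine Supplies.isLinkable (x := X \ D.inEdges X v) ⟨fun e he => ?_, fun u hu => ?_⟩
  · simp only [inEdges, Finset.mem_sdiff, Finset.mem_filter, not_and] at he
    simpa [avoiding] using he.2 he.1
  · have h4 := D.excess_union (Finset.sdiff_disjoint (s := D.inEdges X v) (t := X)) u
    rw [hunion, hex u hu] at h4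
    have h5 := excess_of_forall_head_eq (D := D) (I := D.inEdges X v) (v := v)
      (fun e he => (Finset.mem_filter.1 he).2) u
    rw [h5, heq] at h4
    rw [heq]
    omega

section Union

variable {F : Finset E}

/-- Restricting every node to a base of its entering edges destroys no connectivity. By induction
along a topological order: a violating cut can be enlarged by the minimum cuts of the nodes inside
it until every edge that enters it, except at `v`, is an edge of `F`. -/
theorem card_inEdges_le_card_entering [Fintype V] (hD : D.Acyclic)
    (h : ∀ v, v ≠ D.root →
      ∃ x, D.IsGreedyState w v (D.inEdges Finset.univ v) (D.inEdges F v) x)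
    (v : V) (T : Finset V) (hvT : v ∈ T) (hrT : D.root ∉ T) :
    (D.inEdges F v).card ≤ (D.entering F T).card := by
  classical
  obtain ⟨ord, hord⟩ := hD.exists_topological_order
  suffices H : ∀ n v, ord v = n → ∀ T : Finset V, v ∈ T → D.root ∉ T →
      (D.inEdges F v).card ≤ (D.entering F T).card from H _ v rfl T hvT hrT
  intro n
  induction n using Nat.strong_induction_on with
  | _ n ih =>
    intro v hn T hvT hrT
    have hvr : v ≠ D.root := fun h => hrT (h ▸ hvT)
    let S : V → Finset V := fun v => Finset.univ.filter fun u => ord u < ord v ∨ u = v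
    have hS : ∀ u v, u ∈ S v ↔ ord u < ord v ∨ u = v := fun u v => by simp [S]
    -- Both `F` and the whole edge set lose no edge when a cut is restricted to `S v`.
    have hrestrict : ∀ (A : Finset E) (T : Finset V) (v : V),
        (D.entering A (T ∩ S v)).card ≤ (D.entering A T).card := by
      intro A T v
      refine Finset.card_le_card fun e he => ?_
      simp only [entering, Finset.mem_filter, Finset.mem_inter, not_and, hS] at he ⊢
      refine ⟨he.1, fun ht => he.2.1 ht ?_, he.2.2.1⟩
      rcases he.2.2.2 with h1 | h1
      · exact Or.inl ((hord e).trans h1)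
      · exact Or.inl (h1 ▸ hord e)
    let cand : Finset (Finset V) := Finset.univ.filter fun T' =>
      v ∈ T' ∧ D.root ∉ T' ∧ T' ⊆ S v ∧ (D.entering F T').card ≤ (D.entering F T).card
    have hcand : ∀ T', T' ∈ cand ↔ v ∈ T' ∧ D.root ∉ T' ∧ T' ⊆ S v ∧
        (D.entering F T').card ≤ (D.entering F T).card := fun T' => by simp [cand]
    obtain ⟨M, hM, hmax⟩ := Finset.exists_max_image cand Finset.card ⟨T ∩ S v, (hcand _).2
      ⟨Finset.mem_inter.2 ⟨hvT, (hS v v).2 (Or.inr rfl)⟩,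
        fun h' => hrT (Finset.mem_inter.1 h').1, Finset.inter_subset_right, hrestrict F T v⟩⟩
    obtain ⟨hvM, hrM, hMS, hMcard⟩ := (hcand M).1 hM
    refine le_trans ?_ hMcard
    -- A rejected edge into a node `u ≠ v` of `M` starts in `M`.
    have hrej : ∀ e, D.head e ∈ M → D.head e ≠ v → e ∉ F → D.tail e ∈ M := by
      intro e heM hev heF
      have hur : D.head e ≠ D.root := fun h' => hrM (h' ▸ heM)
      have hlt : ord (D.head e) < ord v := ((hS _ _).1 (hMS heM)).resolve_right hev
      obtain ⟨x, hx⟩ := h _ hur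
      obtain ⟨C, huC, hrC, hCrej, hCcard⟩ := hx.exists_minCut hur
      set u := D.head e with hu
      have huC' : u ∈ C ∩ S u := Finset.mem_inter.2 ⟨huC, (hS u u).2 (Or.inr rfl)⟩
      have h1 := D.card_entering_union_add_inter F M (C ∩ S u)
      have h2 := ih (ord u) (hn ▸ hlt) u rfl (M ∩ (C ∩ S u)) (Finset.mem_inter.2 ⟨heM, huC'⟩)
        fun h' => hrM (Finset.mem_inter.1 h').1
      have h3 := D.card_entering_mono (Finset.subset_univ F) (C ∩ S u)
      have h4 := hrestrict Finset.univ C u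
      have h5 : M ∪ (C ∩ S u) ∈ cand := by
        refine (hcand _).2 ⟨Finset.mem_union_left _ hvM, ?_, Finset.union_subset hMS ?_, by omega⟩
        · rw [Finset.mem_union, not_or]
          exact ⟨hrM, fun h' => hrC (Finset.mem_inter.1 h').1⟩
        · intro z hz
          rcases (hS _ _).1 (Finset.mem_inter.1 hz).2 with hz | rfl
          · exact (hS _ _).2 (Or.inl (hz.trans hlt))
          · exact (hS _ _).2 (Or.inl hlt)
      have h6 : M ∪ (C ∩ S u) = M :=
        (Finset.eq_of_subset_of_card_le Finset.subset_union_left (hmax _ h5)).symm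
      rw [← h6]
      refine Finset.mem_union_right _ (Finset.mem_inter.2 ⟨hCrej e rfl fun h' => heF ?_, ?_⟩)
      · exact (Finset.mem_filter.1 h').1
      · exact (hS _ _).2 (Or.inl (hord e))
    obtain ⟨x, hx⟩ := h v hvr
    have hlink := hx.supplies.isLinkable M hrM
    have hsub : D.entering (D.avoiding v) M ∪ (D.inEdges F v \ D.tailsIn (D.inEdges F v) M) ⊆
        D.entering F M := by
      intro e he
      simp only [entering, avoiding, tailsIn, inEdges, Finset.mem_filter, Finset.mem_univ,
        true_and, Finset.mem_union, Finset.mem_sdiff, not_and] at he ⊢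
      rcases he with ⟨h1, h2, h3⟩ | ⟨⟨h1, h2⟩, h3⟩
      · exact ⟨by_contra fun h' => h2 (hrej e h3 h1 h'), h2, h3⟩
      · exact ⟨h1, h3 ⟨h1, h2⟩, h2 ▸ hvM⟩
    have hdisj : Disjoint (D.entering (D.avoiding v) M)
        (D.inEdges F v \ D.tailsIn (D.inEdges F v) M) := by
      refine Finset.disjoint_left.2 fun e he he' => ?_
      simp only [entering, avoiding, inEdges, Finset.mem_filter, Finset.mem_univ, true_and,
        Finset.mem_sdiff] at he he'
      exact he.1 he'.1.2
    have h1 := Finset.card_le_card hsub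
    rw [Finset.card_union_of_disjoint hdisj] at h1
    have h2 := Finset.card_sdiff_add_card_eq_card
      (Finset.filter_subset (fun e => D.tail e ∈ M) (D.inEdges F v))
    unfold tailsIn at h1 hlink
    omega

theorem isMinWeightMaximalFlame_of_greedy [Fintype V] (hD : D.Acyclic)
    (hroot : ∀ e ∈ F, D.head e ≠ D.root)
    (h : ∀ v, v ≠ D.root →
      ∃ x, D.IsGreedyState w v (D.inEdges Finset.univ v) (D.inEdges F v) x) :
    D.IsMinWeightMaximalFlame w F := by
  have hmax : ∀ v, v ≠ D.root → ∀ l, D.HasFlow Finset.univ v l → l ≤ (D.inEdges F v).card := by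
    intro v hv l hl
    obtain ⟨x, hx⟩ := h v hv
    obtain ⟨C, hvC, hrC, -, hC⟩ := hx.exists_minCut hv
    exact (hl.le_card_entering hvC hrC).trans hC
  have hconnD : ∀ v, v ≠ D.root → D.localConn Finset.univ v = (D.inEdges F v).card := by
    intro v hv
    obtain ⟨x, hx⟩ := h v hv
    exact localConn_eq hD hv hx.hasFlow (hmax v hv)
  have hconnF : ∀ v, v ≠ D.root → D.localConn F v = (D.inEdges F v).card := fun v hv =>
    localConn_eq hD hv
      (hasFlow_of_forall_le_card_entering hv _ (card_inEdges_le_card_entering hD h v))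
      fun l hl => hmax v hv l (hl.mono (Finset.subset_univ _))
  refine ⟨⟨fun v hv => hconnF v hv, fun v hv => (hconnF v hv).trans (hconnD v hv).symm⟩, ?_⟩
  rintro F' ⟨hflame, hF'⟩
  have hle : ∀ v, v ≠ D.root → ∑ e ∈ D.inEdges F v, w e ≤ ∑ e ∈ D.inEdges F' v, w e := by
    intro v hv
    have hcard : (D.inEdges F' v).card = (D.inEdges F v).card :=
      (hflame v hv).symm.trans ((hF' v hv).trans (hconnD v hv))
    have hlink : D.IsLinkable v (D.inEdges F' v) := by
      refine isLinkable_of_hasFlow hv ?_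
      have := hasFlow_localConn (D := D) F' hv
      rwa [hflame v hv] at this
    obtain ⟨x, hx⟩ := h v hv
    have h1 := hx.weight _ hlink (∑ e, w e) fun e _ =>
      Finset.single_le_sum (fun _ _ => zero_le) (Finset.mem_univ e)
    have h2 : D.inEdges F' v ∩ D.inEdges Finset.univ v = D.inEdges F' v :=
      Finset.inter_eq_left.2 (Finset.filter_subset_filter _ (Finset.subset_univ _))
    rw [h2, hcard] at h1
    exact le_of_add_le_add_right h1
  have hfib : ∀ A : Finset E, ∑ e ∈ A, w e = ∑ v, ∑ e ∈ D.inEdges A v, w e := fun A =>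
    (Finset.sum_fiberwise A D.head w).symm
  rw [hfib F, hfib F']
  refine Finset.sum_le_sum fun v _ => ?_
  by_cases hv : v = D.root
  · have : D.inEdges F v = ∅ :=
      Finset.filter_eq_empty_iff.2 fun {e} he h' => hroot e he (h'.trans hv)
    rw [this]; simp
  · exact hle v hv

end Union

end Greedy

end RootedDigraph

/-! ### Total correctness with time bounds -/

namespace RAM

/-- Started in `s`, the program `p` halts within `T` time units in a state that satisfies `Q`. -/
def Terminates (w : ℕ → ℚ≥0) (p : Program) (s : State) (T : ℕ) (Q : State → Prop) : Prop :=
  ∃ s' t, Runs w p s s' t ∧ t ≤ T ∧ Q s'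

/-- The program contains an assignment to the variable `x`. -/
def Program.assigns (x : ℕ) : Program → Bool
  | .skip => false
  | .assign y _ => x == y
  | .store _ _ _ => false
  | .seq p q => p.assigns x || q.assigns x
  | .branch _ p q => p.assigns x || q.assigns x
  | .loop _ p => p.assigns x

/-- The program contains a store operation on the array `a`. -/
def Program.stores (a : ℕ) : Program → Bool
  | .skip => false
  | .assign _ _ => false
  | .store b _ _ => a == b
  | .seq p q => p.stores a || q.stores a
  | .branch _ p q => p.stores a || q.stores a
  | .loop _ p => p.stores a

/-- `s'` agrees with `s` on all variables and arrays that `p` does not write to. -/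
structure Frame (p : Program) (s s' : State) : Prop where
  var : ∀ x, p.assigns x = false → s'.var x = s.var x
  arr : ∀ a, p.stores a = false → s'.arr a = s.arr a

theorem Frame.refl (p : Program) (s : State) : Frame p s s := ⟨fun _ _ => rfl, fun _ _ => rfl⟩

theorem Frame.trans {p : Program} {s s' s'' : State} (h : Frame p s s') (h' : Frame p s' s'') :
    Frame p s s'' :=
  ⟨fun x hx => (h'.var x hx).trans (h.var x hx), fun a ha => (h'.arr a ha).trans (h.arr a ha)⟩

theorem Runs.frame {w : ℕ → ℚ≥0} {p : Program} {s s' : State} {t : ℕ} (h : Runs w p s s' t) :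
    Frame p s s' := by
  induction h with
  | skip s => exact Frame.refl _ _
  | assign s x e =>
    refine ⟨fun y hy => ?_, fun _ _ => rfl⟩
    have : y ≠ x := by simpa [Program.assigns] using hy
    simp [this]
  | store s a i e =>
    refine ⟨fun _ _ => rfl, fun b hb => ?_⟩
    have : b ≠ a := by simpa [Program.stores] using hb
    simp [this]
  | seq _ _ ih ih' =>
    refine ⟨fun x hx => ?_, fun a ha => ?_⟩
    · simp only [Program.assigns, Bool.or_eq_false_iff] at hx
      rw [ih'.var x hx.2, ih.var x hx.1]
    · simp only [Program.stores, Bool.or_eq_false_iff] at ha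
      rw [ih'.arr a ha.2, ih.arr a ha.1]
  | branch_true _ _ ih =>
    refine ⟨fun x hx => ?_, fun a ha => ?_⟩
    · simp only [Program.assigns, Bool.or_eq_false_iff] at hx
      exact ih.var x hx.1
    · simp only [Program.stores, Bool.or_eq_false_iff] at ha
      exact ih.arr a ha.1
  | branch_false _ _ ih =>
    refine ⟨fun x hx => ?_, fun a ha => ?_⟩
    · simp only [Program.assigns, Bool.or_eq_false_iff] at hx
      exact ih.var x hx.2
    · simp only [Program.stores, Bool.or_eq_false_iff] at ha
      exact ih.arr a ha.2
  | loop_false _ => exact Frame.refl _ _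
  | loop_true _ _ _ ih ih' =>
    exact ⟨fun x hx => (ih'.var x hx).trans (ih.var x hx),
      fun a ha => (ih'.arr a ha).trans (ih.arr a ha)⟩

variable {w : ℕ → ℚ≥0} {p q : Program} {b : Test} {s : State} {T T' : ℕ} {Q Q' : State → Prop}

theorem Terminates.mono (h : Terminates w p s T Q) (hT : T ≤ T') (hQ : ∀ s', Q s' → Q' s') :
    Terminates w p s T' Q' :=
  let ⟨s', t, hr, ht, hq⟩ := h
  ⟨s', t, hr, ht.trans hT, hQ s' hq⟩

theorem Terminates.frame (h : Terminates w p s T Q) :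
    Terminates w p s T fun s' => Frame p s s' ∧ Q s' :=
  let ⟨s', t, hr, ht, hq⟩ := h
  ⟨s', t, hr, ht, hr.frame, hq⟩

theorem Terminates.seq (h : Terminates w p s T fun s' => Terminates w q s' T' Q) :
    Terminates w (.seq p q) s (T + T') Q :=
  let ⟨_, _, hr, ht, s'', _, hr', ht', hq⟩ := h
  ⟨s'', _, .seq hr hr', Nat.add_le_add ht ht', hq⟩

theorem Terminates.branch (h : b.Holds w s → Terminates w p s T Q)
    (h' : ¬ b.Holds w s → Terminates w q s T Q) :
    Terminates w (.branch b p q) s (b.cost + T + 1) Q := by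
  by_cases hb : b.Holds w s
  · obtain ⟨s', t, hr, ht, hq⟩ := h hb
    exact ⟨s', _, .branch_true hb hr, by omega, hq⟩
  · obtain ⟨s', t, hr, ht, hq⟩ := h' hb
    exact ⟨s', _, .branch_false hb hr, by omega, hq⟩

/-- A loop terminates if each execution of its body is paid for by the decrease of the
potential `Φ`. -/
theorem Terminates.loop (I : State → Prop) (Φ : State → ℕ) (hI : I s)
    (step : ∀ s', Frame p s s' → I s' → b.Holds w s' →
      ∃ T, Terminates w p s' T fun s'' => I s'' ∧ T + b.cost + 1 + Φ s'' ≤ Φ s') :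
    Terminates w (.loop b p) s (Φ s + b.cost + 1)
      fun s' => Frame p s s' ∧ I s' ∧ ¬ b.Holds w s' := by
  suffices H : ∀ n s', Φ s' = n → Frame p s s' → I s' →
      Terminates w (.loop b p) s' (Φ s' + b.cost + 1)
        fun s' => Frame p s s' ∧ I s' ∧ ¬ b.Holds w s' from
    H _ s rfl (Frame.refl _ _) hI
  intro n
  induction n using Nat.strong_induction_on with
  | _ n ih =>
    intro s' hn hf hI'
    by_cases hb : b.Holds w s'
    · obtain ⟨T, hT⟩ := step s' hf hI' hb
      obtain ⟨s₁, t, hr, ht, hf₁, hI₁, hΦ⟩ := hT.frame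
      obtain ⟨s₂, t', hr', ht', hq⟩ := ih (Φ s₁) (by omega) s₁ rfl (hf.trans hf₁) hI₁
      exact ⟨s₂, _, .loop_true hb hr hr', by omega, hq⟩
    · exact ⟨s', _, .loop_false hb, by omega, hf, hI', hb⟩

/-- The program contains no loop. -/
def Program.loopFree : Program → Bool
  | .skip => true
  | .assign _ _ => true
  | .store _ _ _ => true
  | .seq p q => p.loopFree && q.loopFree
  | .branch _ p q => p.loopFree && q.loopFree
  | .loop _ _ => false

open Classical in
/-- The result of running a program without loops; loops are ignored. -/
noncomputable def Program.exec (w : ℕ → ℚ≥0) : Program → State → State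
  | .skip, s => s
  | .assign x e, s => ⟨Function.update s.var x (e.eval s), s.arr⟩
  | .store a i e, s =>
    ⟨s.var, Function.update s.arr a (Function.update (s.arr a) (i.eval s) (e.eval s))⟩
  | .seq p q, s => q.exec w (p.exec w s)
  | .branch b p q, s => if b.Holds w s then p.exec w s else q.exec w s
  | .loop _ _, s => s

/-- An upper bound for the running time of a program without loops. -/
def Program.bound : Program → ℕ
  | .skip => 1
  | .assign _ e => e.cost + 1
  | .store _ i e => i.cost + e.cost + 1
  | .seq p q => p.bound + q.bound
  | .branch b p q => b.cost + (p.bound + q.bound) + 1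
  | .loop _ _ => 0

theorem terminates_of_loopFree (hp : p.loopFree = true) (hQ : Q (p.exec w s)) :
    Terminates w p s p.bound Q := by
  suffices H : ∀ s, Terminates w p s p.bound fun s' => s' = p.exec w s from
    (H s).mono le_rfl fun s' hs' => hs' ▸ hQ
  clear hQ
  induction p with
  | skip => exact fun s => ⟨_, _, .skip s, le_rfl, rfl⟩
  | assign x e => exact fun s => ⟨_, _, .assign s x e, le_rfl, rfl⟩
  | store a i e => exact fun s => ⟨_, _, .store s a i e, le_rfl, rfl⟩
  | seq p q ihp ihq =>
    intro s
    simp only [Program.loopFree, Bool.and_eq_true] at hp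
    exact ((ihp hp.1 s).mono le_rfl fun s' hs' => hs' ▸ ihq hp.2 s').seq
  | branch b p q ihp ihq =>
    intro s
    simp only [Program.loopFree, Bool.and_eq_true] at hp
    refine Terminates.branch (fun hb => ?_) fun hb => ?_
    · refine (ihp hp.1 s).mono (by omega) ?_
      rintro _ rfl
      simp only [Program.exec, if_pos hb]
    · refine (ihq hp.2 s).mono (by omega) ?_
      rintro _ rfl
      simp only [Program.exec, if_neg hb]
  | loop b p => simp [Program.loopFree] at hp

end RAM

/-! ### The program -/

namespace RAM

namespace Flame

/- The variables 0, 1 and 2 hold the input numbers, 3 is a loop counter, 4 counts the processed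
edges, 5 is the current edge, 6 and 7 are the two ends of the queue of the search, 8 is a list
pointer, and 9 is the current node of the augmentation. -/

abbrev edgeCount : Expr := .var 1
abbrev root : Expr := .var 2
abbrev counter : Expr := .var 3
abbrev round : Expr := .var 4
abbrev edge : Expr := .var 5
abbrev front : Expr := .var 6
abbrev back : Expr := .var 7
abbrev pointer : Expr := .var 8
abbrev node : Expr := .var 9

abbrev tailOf (e : Expr) : Expr := .get 0 e
abbrev headOf (e : Expr) : Expr := .get 1 e

/-- First element of the list of edges that leave a node. The pointer to the edge `e` is `e + 1`,
and `0` is the null pointer. -/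
abbrev firstOut (v : Expr) : Expr := .get 3 v
/-- Successor of an edge in the list of the edges with the same tail. -/
abbrev nextOut (e : Expr) : Expr := .get 4 e
/-- First element of the list of edges that enter a node. -/
abbrev firstIn (v : Expr) : Expr := .get 5 v
/-- Successor of an edge in the list of the edges with the same head. -/
abbrev nextIn (e : Expr) : Expr := .get 6 e
/-- Equal to `1` if the edge has been processed, and to `0` otherwise. -/
abbrev isDone (e : Expr) : Expr := .get 7 e

/-- The edge `e` carries flow for the current node `v` if its label is `v + 1`. -/
abbrev flowLabel (e : Expr) : Expr := .get 8 e
/-- The round in which a node has been reached for the last time. -/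
abbrev reached (v : Expr) : Expr := .get 9 v
/-- The edge by which a node has been reached. -/
abbrev parent (v : Expr) : Expr := .get 10 v
/-- The nodes reached in the current round, in the order of the search. -/
abbrev queue (i : Expr) : Expr := .get 11 i
/-- The label of the edges that carry flow for the head of the current edge. -/
abbrev currentLabel : Expr := .succ (headOf edge)

/-- Inserts each edge into the lists of its tail and of its head. -/
def buildStep : Program :=
  .seq (.store 4 counter (firstOut (tailOf counter))) <|
  .seq (.store 3 (tailOf counter) (.succ counter)) <|
  .seq (.store 6 counter (firstIn (headOf counter))) <|
  .seq (.store 5 (headOf counter) (.succ counter)) <|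
  .assign 3 (.succ counter)

def build : Program := .loop (.lt counter edgeCount) buildStep

/-- The edge `counter` is preferred to the edge `edge`: the latter has been processed already, or
the former has a smaller head, or the same head and at most the same weight. -/
def preferred : Test :=
  .not (.and (.eq (isDone edge) (.const 0))
    (.and (.not (.lt (headOf counter) (headOf edge)))
      (.not (.and (.eq (headOf counter) (headOf edge)) (.weightLE counter edge)))))

def selectStep : Program :=
  .seq (.branch (.and (.eq (isDone counter) (.const 0)) preferred) (.assign 5 counter) .skip)
    (.assign 3 (.succ counter))

/-- Finds the next unprocessed edge in the order by head and weight. -/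
def select : Program :=
  .seq (.seq (.assign 5 (.const 0)) (.assign 3 (.const 0))) <|
  .loop (.lt counter edgeCount) selectStep

/-- One step through a linked list of edges; array `next` holds the successors, and array `far` the
other end of each edge. That end is put into the queue if `b` holds and it is new. -/
def scanStep (next far : ℕ) (b : Test) : Program :=
  .seq (.assign 8 (.pred pointer)) <|
  .seq (.branch (.and b (.not (.eq (reached (.get far pointer)) round)))
    (.seq (.store 9 (.get far pointer) round) <|
     .seq (.store 10 (.get far pointer) pointer) <|
     .seq (.store 11 back (.get far pointer)) <|
     .assign 7 (.succ back))
    .skip) <|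
  .assign 8 (.get next pointer)

def scan (first next far : ℕ) (b : Test) : Program :=
  .seq (.assign 8 (.get first (queue front))) <|
  .loop (.not (.eq pointer (.const 0))) (scanStep next far b)

/-- The edge `pointer` has a forward residual arc: it carries no flow, and it does not enter the
current node. -/
def forwardTest : Test :=
  .and (.not (.eq (flowLabel pointer) currentLabel)) (.not (.eq (headOf pointer) (headOf edge)))

/-- The edge `pointer` has a backward residual arc: it carries flow. -/
def backwardTest : Test := .eq (flowLabel pointer) currentLabel

def searchStep : Program :=
  .seq (scan 3 4 1 forwardTest) <|
  .seq (scan 5 6 0 backwardTest) <|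
  .assign 6 (.succ front)

def searchInit : Program :=
  .seq (.store 9 root round) <|
  .seq (.store 11 (.const 0) root) <|
  .seq (.assign 6 (.const 0)) <|
  .assign 7 (.const 1)

/-- Breadth-first search from the root in the residual graph. -/
def search : Program := .seq searchInit (.loop (.lt front back) searchStep)

def augmentStep : Program :=
  .branch (.eq (flowLabel (parent node)) currentLabel)
    (.seq (.store 8 (parent node) (.const 0)) (.assign 9 (headOf (parent node))))
    (.seq (.store 8 (parent node) currentLabel) (.assign 9 (tailOf (parent node))))

/-- Accepts the current edge, and switches the residual arcs on the path from the root to its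
tail. -/
def augment : Program :=
  .seq (.seq (.store 2 edge (.const 1)) (.assign 9 (tailOf edge))) <|
  .loop (.not (.eq node root)) augmentStep

def roundInit : Program := .assign 4 (.succ round)

def processEdge : Program :=
  .branch (.eq (headOf edge) root) .skip <|
  .seq search (.branch (.eq (reached (tailOf edge)) round) augment .skip)

def roundStep : Program :=
  .seq roundInit <| .seq select <| .seq (.store 7 edge (.const 1)) processEdge

/-- The greedy algorithm: the edges are processed in the order by head and weight, and an edge is
accepted if the flow for its head can be augmented to its tail. -/
def program : Program := .seq build (.loop (.lt round edgeCount) roundStep)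

end Flame

/-! ### Linked lists of edges -/

/-- The pointer to the largest `a < k` with `key a = u`; pointers are shifted by one, and `0` is the
null pointer. -/
def lastPtr (key : ℕ → ℕ) (u : ℕ) : ℕ → ℕ
  | 0 => 0
  | k + 1 => if key k = u then k + 1 else lastPtr key u k

/-- The number of `a < k` with `key a = u`: the length of the list that starts at the pointer
`lastPtr key u k`. -/
def countBelow (key : ℕ → ℕ) (u k : ℕ) : ℕ := ((Finset.range k).filter fun a => key a = u).card

theorem countBelow_succ (key : ℕ → ℕ) (u k : ℕ) :
    countBelow key u (k + 1) = countBelow key u k + if key k = u then 1 else 0 := by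
  unfold countBelow
  rw [Finset.range_add_one, Finset.filter_insert]
  split_ifs
  · rw [Finset.card_insert_of_notMem (by simp)]
  · rfl

theorem countBelow_lastPtr (key : ℕ → ℕ) (u k : ℕ) :
    countBelow key u (lastPtr key u k) = countBelow key u k := by
  induction k with
  | zero => rfl
  | succ k ih =>
    unfold lastPtr
    split_ifs with h
    · rfl
    · rw [ih, countBelow_succ, if_neg h, add_zero]

theorem lastPtr_le (key : ℕ → ℕ) (u k : ℕ) : lastPtr key u k ≤ k := by
  induction k with
  | zero => exact le_rfl
  | succ k ih => unfold lastPtr; split_ifs <;> omega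

/-- The list that starts at `lastPtr key u k` omits no `a < k` with `key a = u`. -/
theorem key_ne_of_lastPtr_le {key : ℕ → ℕ} {u k a : ℕ} (h : lastPtr key u k ≤ a) (ha : a < k) :
    key a ≠ u := by
  induction k with
  | zero => omega
  | succ k ih =>
    unfold lastPtr at h
    split_ifs at h with hk
    · omega
    · rcases Nat.lt_succ_iff_lt_or_eq.1 ha with h' | rfl
      · exact ih h h'
      · exact hk

theorem key_of_lastPtr_eq {key : ℕ → ℕ} {u k a : ℕ} (h : lastPtr key u k = a + 1) : key a = u := by
  induction k with
  | zero => simp [lastPtr] at h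
  | succ k ih =>
    unfold lastPtr at h
    split_ifs at h with hk
    · obtain rfl : k = a := by omega
      exact hk
    · exact ih h

/-! ### Breadth-first search -/

/-- The state of a search from `r`: `queue 0, …, queue (n - 1)` are the nodes reached so far, they
are labelled `c` in `reached`, and `parent` holds an edge by which they have been reached from
an earlier node. `Arc a u u'` says that the edge `a` allows the step from `u` to `u'`. -/
structure SearchInv (m c r : ℕ) (Arc : ℕ → ℕ → ℕ → Prop) (reached parent queue : ℕ → ℕ) (n : ℕ) :
    Prop where
  pos : 0 < n
  root : queue 0 = r
  le : ∀ u, reached u ≤ c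
  reached_iff : ∀ u, reached u = c ↔ ∃ i < n, queue i = u
  inj : ∀ i < n, ∀ j < n, queue i = queue j → i = j
  tree : ∀ i < n, 0 < i → parent (queue i) < m ∧
    ∃ j < i, Arc (parent (queue i)) (queue j) (queue i)

section Search

variable {m c r n : ℕ} {Arc : ℕ → ℕ → ℕ → Prop} {reached parent queue : ℕ → ℕ}

theorem SearchInv.init (hreached : ∀ u, reached u < c) (hqueue : queue 0 = r) :
    SearchInv m c r Arc (Function.update reached r c) parent queue 1 where
  pos := Nat.one_pos
  root := hqueue
  le u := by
    by_cases hu : u = r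
    · simp [hu]
    · simpa [hu] using (hreached u).le
  reached_iff u := by
    by_cases hu : u = r
    · subst hu; simpa using hqueue
    · have : queue 0 ≠ u := by rw [hqueue]; exact Ne.symm hu
      simp [hu, (hreached u).ne, this]
  inj i hi j hj _ := by omega
  tree i hi hi' := by omega

theorem SearchInv.visit (h : SearchInv m c r Arc reached parent queue n) {a i u : ℕ} (ha : a < m)
    (hi : i < n) (harc : Arc a (queue i) u) (hu : reached u ≠ c) :
    SearchInv m c r Arc (Function.update reached u c) (Function.update parent u a)
      (Function.update queue n u) (n + 1) := by
  have hold : ∀ j < n, Function.update queue n u j = queue j := fun j hj =>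
    Function.update_of_ne hj.ne _ _
  have hnew : ∀ j < n, queue j ≠ u := fun j hj h' => hu ((h.reached_iff u).2 ⟨j, hj, h'⟩)
  refine ⟨Nat.succ_pos _, (hold 0 h.pos).trans h.root, fun z => ?_, fun z => ?_,
    fun j hj k hk hjk => ?_,
    fun j hj hj0 => ?_⟩
  · by_cases hz : z = u
    · simp [hz]
    · simpa [hz] using h.le z
  · by_cases hz : z = u
    · subst hz
      simp only [Function.update_self, true_iff]
      exact ⟨n, Nat.lt_succ_self n, Function.update_self _ _ _⟩
    · rw [Function.update_of_ne hz, h.reached_iff]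
      constructor
      · rintro ⟨j, hj, rfl⟩; exact ⟨j, hj.trans (Nat.lt_succ_self n), hold j hj⟩
      · rintro ⟨j, hj, hjz⟩
        rcases Nat.lt_succ_iff_lt_or_eq.1 hj with hj | rfl
        · exact ⟨j, hj, (hold j hj).symm.trans hjz⟩
        · rw [Function.update_self] at hjz; exact absurd hjz.symm hz
  · rcases Nat.lt_succ_iff_lt_or_eq.1 hj with hj | rfl <;>
    rcases Nat.lt_succ_iff_lt_or_eq.1 hk with hk | rfl
    · rw [hold j hj, hold k hk] at hjk; exact h.inj j hj k hk hjk
    · rw [hold j hj, Function.update_self] at hjk; exact absurd hjk (hnew j hj)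
    · rw [hold k hk, Function.update_self] at hjk; exact absurd hjk.symm (hnew k hk)
    · rfl
  · rcases Nat.lt_succ_iff_lt_or_eq.1 hj with hj | rfl
    · obtain ⟨h1, k, hk, h2⟩ := h.tree j hj hj0
      rw [hold j hj, Function.update_of_ne (hnew j hj)]
      exact ⟨h1, k, hk, by rwa [hold k (hk.trans hj)]⟩
    · rw [Function.update_self, Function.update_self]
      exact ⟨ha, i, hi, by rwa [hold i hi]⟩

theorem SearchInv.reached_of_agree {reached' parent' queue' : ℕ → ℕ} {n' : ℕ}
    (h : SearchInv m c r Arc reached parent queue n)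
    (h' : SearchInv m c r Arc reached' parent' queue' n') (hn : n ≤ n')
    (hq : ∀ i < n, queue' i = queue i) {u : ℕ} (hu : reached u = c) : reached' u = c := by
  obtain ⟨i, hi, rfl⟩ := (h.reached_iff u).1 hu
  exact (h'.reached_iff _).2 ⟨i, hi.trans_le hn, hq i hi⟩

/-- The queue positions turn the reached nodes into a search tree. -/
theorem SearchInv.exists_rank (h : SearchInv m c r Arc reached parent queue n) :
    ∃ pos : ℕ → ℕ, (∀ u, reached u = c → pos u < n) ∧
      ∀ u, reached u = c → u ≠ r → parent u < m ∧
        ∃ u', reached u' = c ∧ pos u' < pos u ∧ Arc (parent u) u' u := by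
  classical
  let pos : ℕ → ℕ := fun u => if h : ∃ i < n, queue i = u then h.choose else 0
  have hpos : ∀ i < n, pos (queue i) = i := fun i hi => by
    have hex : ∃ j < n, queue j = queue i := ⟨i, hi, rfl⟩
    have : pos (queue i) = hex.choose := dif_pos hex
    rw [this]
    exact h.inj _ hex.choose_spec.1 i hi hex.choose_spec.2
  refine ⟨pos, fun u hu => ?_, fun u hu hur => ?_⟩
  · obtain ⟨i, hi, rfl⟩ := (h.reached_iff u).1 hu
    rwa [hpos i hi]
  · obtain ⟨i, hi, rfl⟩ := (h.reached_iff u).1 hu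
    have hi0 : 0 < i := Nat.pos_of_ne_zero fun h0 => hur (by rw [h0, h.root])
    obtain ⟨h1, j, hj, h2⟩ := h.tree i hi hi0
    refine ⟨h1, queue j, (h.reached_iff _).2 ⟨j, hj.trans hi, rfl⟩, ?_, h2⟩
    rwa [hpos i hi, hpos j (hj.trans hi)]

end Search

namespace Flame

variable {w : ℕ → ℚ≥0}

/-- The time for one step through a list, including the test of the loop. -/
def scanCost (next far : ℕ) (b : Test) : ℕ :=
  (scanStep next far b).bound + (Test.not (.eq pointer (.const 0))).cost + 1

/-- The time that a scan takes in addition to its steps. -/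
def scanInitCost (first : ℕ) : ℕ :=
  (Program.assign 8 (.get first (queue front))).bound +
    (Test.not (.eq pointer (.const 0))).cost + 1

open Classical in
/-- Scanning the list of the edges `a` with `key a = u`, where `u` is the front of the queue,
reaches `far a` for each of these edges that is eligible, that is, satisfies `El` or equivalently the
test `b`. The time is linear in the length of the list. -/
theorem terminates_scan {first next far : ℕ} {b : Test} {key : ℕ → ℕ} {El : ℕ → Prop} {s : State}
    {m r : ℕ} {Arc : ℕ → ℕ → ℕ → Prop}
    (hfar : far < 2) (hnext : 2 < next) (hnext' : next < 7)
    (hfst : ∀ u, s.arr first u = lastPtr key u m)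
    (hnxt : ∀ a < m, s.arr next a = lastPtr key (key a) a)
    (hb : ∀ s', (∀ x, x ≠ 7 → x ≠ 8 → s'.var x = s.var x) →
      (∀ a < 9, s'.arr a = s.arr a) → (b.Holds w s' ↔ El (s'.var 8)))
    (harc : ∀ a < m, El a → Arc a (key a) (s.arr far a))
    (hinv : SearchInv m (s.var 4) r Arc (s.arr 9) (s.arr 10) (s.arr 11) (s.var 7))
    (hfront : s.var 6 < s.var 7) :
    Terminates w (scan first next far b) s
      (scanCost next far b * countBelow key (s.arr 11 (s.var 6)) m + scanInitCost first)
      fun s' =>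
        SearchInv m (s.var 4) r Arc (s'.arr 9) (s'.arr 10) (s'.arr 11) (s'.var 7) ∧
        s.var 7 ≤ s'.var 7 ∧ (∀ i < s.var 7, s'.arr 11 i = s.arr 11 i) ∧
        ∀ a < m, key a = s.arr 11 (s.var 6) → El a → s'.arr 9 (s.arr far a) = s.var 4 := by
  set u := s.arr 11 (s.var 6) with hu
  have hfar9 : far ≠ 9 := by omega
  have hfar10 : far ≠ 10 := by omega
  have hfar11 : far ≠ 11 := by omega
  have hnext9 : next ≠ 9 := by omega
  have hnext10 : next ≠ 10 := by omega
  have hnext11 : next ≠ 11 := by omega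
  let I : State → Prop := fun s' =>
    (∃ k ≤ m, s'.var 8 = lastPtr key u k) ∧
    SearchInv m (s.var 4) r Arc (s'.arr 9) (s'.arr 10) (s'.arr 11) (s'.var 7) ∧
    s.var 7 ≤ s'.var 7 ∧ (∀ i < s.var 7, s'.arr 11 i = s.arr 11 i) ∧
    ∀ a < m, s'.var 8 ≤ a → key a = u → El a → s'.arr 9 (s.arr far a) = s.var 4
  let Φ : State → ℕ := fun s' => scanCost next far b * countBelow key u (s'.var 8)
  refine (Terminates.seq (T := (Program.assign 8 (.get first (queue front))).bound)
    (T' := scanCost next far b * countBelow key u m +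
      (Test.not (.eq pointer (.const 0))).cost + 1)
    (terminates_of_loopFree rfl ?_)).mono (by unfold scanInitCost; omega) fun s' hs' => hs'
  set s₁ := (Program.assign 8 (.get first (queue front))).exec w s with hs₁
  have h1var : ∀ x, x ≠ 8 → s₁.var x = s.var x := fun x hx => by
    simp [hs₁, Program.exec, hx]
  have h1arr : s₁.arr = s.arr := rfl
  have h1p : s₁.var 8 = lastPtr key u m := by
    simp [hs₁, Program.exec, Expr.eval, hfst, hu]
  have hI : I s₁ := by
    refine ⟨⟨m, le_rfl, h1p⟩, ?_, ?_, ?_, ?_⟩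
    · rw [h1arr, h1var 7 (by decide)]; exact hinv
    · rw [h1var 7 (by decide)]
    · rw [h1arr]; exact fun _ _ => rfl
    · intro a ha hle hka
      rw [h1p] at hle
      exact absurd hka (key_ne_of_lastPtr_le hle ha)
  have hΦ : Φ s₁ = scanCost next far b * countBelow key u m := by
    simp only [Φ, h1p, countBelow_lastPtr]
  rw [← hΦ]
  refine (Terminates.loop I Φ hI ?_).mono le_rfl ?_
  · intro s₂ hf ⟨⟨k, hk, hp⟩, hs, hle, hq, hdone⟩ hne
    have hp0 : s₂.var 8 ≠ 0 := by simpa [Test.Holds, Expr.eval] using hne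
    obtain ⟨a, ha⟩ := Nat.exists_eq_succ_of_ne_zero hp0
    have hka : key a = u := key_of_lastPtr_eq (hp.symm.trans ha)
    have ham : a < m := by have := lastPtr_le key u k; omega
    have hvar : ∀ x, x ≠ 7 → x ≠ 8 → s₂.var x = s.var x := fun x h7 h8 => by
      rw [hf.var x (by simp [scanStep, Program.assigns, h7, h8]), h1var x h8]
    have harr : ∀ a < 9, s₂.arr a = s.arr a := fun a ha => by
      have e9 : a ≠ 9 := by omega
      have e10 : a ≠ 10 := by omega
      have e11 : a ≠ 11 := by omega
      rw [hf.arr a (by simp [scanStep, Program.stores, e9, e10, e11]), h1arr]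
    -- The state after the pointer has been turned into an edge number.
    let s₃ : State := ⟨Function.update s₂.var 8 a, s₂.arr⟩
    have hbiff : b.Holds w s₃ ↔ El a := by
      rw [hb s₃ (fun x h7 h8 => by simp [s₃, h8, hvar x h7 h8]) fun a ha => harr a ha]
      simp [s₃]
    have hfar2 : s₂.arr far = s.arr far := harr far (by omega)
    have hnext2 : s₂.arr next a = lastPtr key u a := by
      rw [harr next (by omega), hnxt a ham, hka]
    have hcount : countBelow key u (s₂.var 8) = countBelow key u a + 1 := by
      rw [ha, countBelow_succ, if_pos hka]
    refine ⟨(scanStep next far b).bound, terminates_of_loopFree ?_ ?_⟩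
    · rfl
    set s₄ := (scanStep next far b).exec w s₂ with hs₄
    have hpot : s₄.var 8 = lastPtr key u a → (scanStep next far b).bound +
        (Test.not (.eq pointer (.const 0))).cost + 1 + Φ s₄ ≤ Φ s₂ := by
      intro h8
      simp only [Φ, h8, countBelow_lastPtr, hcount, Nat.mul_add, Nat.mul_one]
      rw [scanCost]; omega
    have hc4 : s₂.var 4 = s.var 4 := hvar 4 (by decide) (by decide)
    have hstep : (scanStep next far b).exec w s₂ = if El a ∧ s₂.arr 9 (s.arr far a) ≠ s.var 4 then
        ⟨Function.update (Function.update (Function.update s₂.var 8 a) 7 (s₂.var 7 + 1)) 8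
            (lastPtr key u a),
          Function.update (Function.update (Function.update s₂.arr
            9 (Function.update (s₂.arr 9) (s.arr far a) (s.var 4)))
            10 (Function.update (s₂.arr 10) (s.arr far a) a))
            11 (Function.update (s₂.arr 11) (s₂.var 7) (s.arr far a))⟩
        else ⟨Function.update s₂.var 8 (lastPtr key u a), s₂.arr⟩ := by
      simp only [scanStep, Program.exec, Expr.eval, Test.Holds, ha, Nat.succ_eq_add_one,
        Nat.add_sub_cancel]
      rw [show (⟨Function.update s₂.var 8 a, s₂.arr⟩ : State) = s₃ from rfl, hbiff]
      simp only [s₃, Function.update_self, ne_eq, hfar2, hc4, Nat.reduceEqDiff,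
        not_false_eq_true, Function.update_of_ne]
      split_ifs with h
      · simp [Function.update_of_ne, hfar9, hfar10, hnext9, hnext10, hnext11, hfar2, hnext2]
      · simp [hnext2]
    by_cases hcond : El a ∧ s₂.arr 9 (s.arr far a) ≠ s.var 4
    · rw [if_pos hcond] at hstep
      have h8 : s₄.var 8 = lastPtr key u a := by rw [hs₄, hstep]; simp
      refine ⟨⟨⟨a, ham.le, h8⟩, ?_, ?_, ?_, ?_⟩, hpot h8⟩
      · rw [hs₄, hstep]
        have harc' := harc a ham hcond.1
        rw [hka, hu, ← hq _ hfront] at harc'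
        simpa using hs.visit ham (hfront.trans_le hle) harc' hcond.2
      · rw [hs₄, hstep]; simp; omega
      · intro i hi
        rw [hs₄, hstep]
        have : i ≠ s₂.var 7 := by omega
        simp [this, hq i hi]
      · intro a' ha' hle' hka' hel
        rw [h8] at hle'
        rw [hs₄, hstep]
        by_cases haa : s.arr far a' = s.arr far a
        · simp [haa]
        · simp only [ne_eq, Nat.reduceEqDiff, not_false_eq_true,
            Function.update_of_ne, Function.update_self, haa]
          refine hdone a' ha' (not_lt.1 fun hlt => ?_) hka' hel
          rcases Nat.lt_succ_iff_lt_or_eq.1 (ha ▸ hlt) with h' | rfl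
          · exact key_ne_of_lastPtr_le hle' h' hka'
          · exact haa rfl
    · rw [if_neg hcond] at hstep
      have h8 : s₄.var 8 = lastPtr key u a := by rw [hs₄, hstep]; simp
      refine ⟨⟨⟨a, ham.le, h8⟩, ?_, ?_, ?_, ?_⟩, hpot h8⟩
      · rw [hs₄, hstep]; simpa using hs
      · rw [hs₄, hstep]; simpa using hle
      · rw [hs₄, hstep]; simpa using hq
      · intro a' ha' hle' hka' hel
        rw [h8] at hle'
        rw [hs₄, hstep]
        by_cases hlt : a' < s₂.var 8
        · rcases Nat.lt_succ_iff_lt_or_eq.1 (ha ▸ hlt) with h' | rfl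
          · exact absurd hka' (key_ne_of_lastPtr_le hle' h')
          · exact by_contra fun h' => hcond ⟨hel, h'⟩
        · exact hdone a' ha' (not_lt.1 hlt) hka' hel
  · rintro s' ⟨-, ⟨-, hs, hle, hq, hdone⟩, h0⟩
    have h0' : s'.var 8 = 0 := by simpa [Test.Holds, Expr.eval] using h0
    exact ⟨hs, hle, hq, fun a ha => hdone a ha (by omega)⟩

variable {m : ℕ} {tl hd : ℕ → ℕ} {s : State}

/-- The state holds a digraph with `m` edges and the lists of the edges at each node. -/
structure HasLists (m : ℕ) (tl hd : ℕ → ℕ) (s : State) : Prop where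
  edgeCount : s.var 1 = m
  tail : s.arr 0 = tl
  head : s.arr 1 = hd
  firstOut : ∀ u, s.arr 3 u = lastPtr tl u m
  nextOut : ∀ a < m, s.arr 4 a = lastPtr tl (tl a) a
  firstIn : ∀ u, s.arr 5 u = lastPtr hd u m
  nextIn : ∀ a < m, s.arr 6 a = lastPtr hd (hd a) a

theorem HasLists.congr {s' : State} (h : HasLists m tl hd s) (hvar : s'.var 1 = s.var 1)
    (harr : ∀ a < 7, a ≠ 2 → s'.arr a = s.arr a) : HasLists m tl hd s' where
  edgeCount := hvar.trans h.edgeCount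
  tail := (harr 0 (by decide) (by decide)).trans h.tail
  head := (harr 1 (by decide) (by decide)).trans h.head
  firstOut := by rw [harr 3 (by decide) (by decide)]; exact h.firstOut
  nextOut := by rw [harr 4 (by decide) (by decide)]; exact h.nextOut
  firstIn := by rw [harr 5 (by decide) (by decide)]; exact h.firstIn
  nextIn := by rw [harr 6 (by decide) (by decide)]; exact h.nextIn

/-- The edge `a` gives an arc from `u` to `u'` in the residual graph of the flow that consists of
the edges with label `v + 1`; edges into `v` are excluded. -/
def ResidualArc (tl hd label : ℕ → ℕ) (v a u u' : ℕ) : Prop :=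
  (tl a = u ∧ hd a = u' ∧ label a ≠ v + 1 ∧ hd a ≠ v) ∨ (hd a = u ∧ tl a = u' ∧ label a = v + 1)

/-- The time for one node in the search, apart from the steps through its lists. -/
def nodeCost : ℕ :=
  scanInitCost 3 + scanInitCost 5 + (Program.assign 6 (.succ front)).bound +
    (Test.lt front back).cost + 1

/-- The coefficient of the linear time bound for the search. -/
def searchCost : ℕ :=
  scanCost 4 1 forwardTest + scanCost 6 0 backwardTest + 2 * nodeCost + searchInit.bound +
    (Test.lt front back).cost + 1

theorem sum_countBelow_le (key : ℕ → ℕ) (N : Finset ℕ) :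
    ∑ u ∈ N, countBelow key u m ≤ m := by
  unfold countBelow
  rw [Finset.sum_card_fiberwise_eq_card_filter]
  exact (Finset.card_filter_le _ _).trans_eq (Finset.card_range m)

/-- The search takes time `O(m)`, since the list of each node is scanned at most once, and all
reached nodes except the root are ends of edges. -/
theorem terminates_search (hs : HasLists m tl hd s) (hlt : ∀ u, s.arr 9 u < s.var 4) :
    Terminates w search s (searchCost * (m + 1)) fun s' =>
      SearchInv m (s.var 4) (s.var 2) (ResidualArc tl hd (s.arr 8) (hd (s.var 5)))
        (s'.arr 9) (s'.arr 10) (s'.arr 11) (s'.var 7) ∧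
      s'.var 7 ≤ 2 * m + 1 ∧
      ∀ a < m, ∀ u u', ResidualArc tl hd (s.arr 8) (hd (s.var 5)) a u u' →
        s'.arr 9 u = s.var 4 → s'.arr 9 u' = s.var 4 := by
  set c := s.var 4 with hc
  set r := s.var 2 with hr
  set X := s.arr 8 with hX
  set v := hd (s.var 5) with hv
  set Arc := ResidualArc tl hd X v with hArc
  -- Every node in the queue lies in `N`, which bounds the length of the queue in terms of `m`.
  let N : Finset ℕ := insert r ((Finset.range m).image tl ∪ (Finset.range m).image hd)
  have hNcard : N.card ≤ 2 * m + 1 := by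
    refine (Finset.card_insert_le _ _).trans (Nat.succ_le_succ ?_)
    refine (Finset.card_union_le _ _).trans ?_
    have h1 := Finset.card_image_le (s := Finset.range m) (f := tl)
    have h2 := Finset.card_image_le (s := Finset.range m) (f := hd)
    rw [Finset.card_range] at h1 h2
    omega
  have hArcN : ∀ a < m, ∀ u u', Arc a u u' → u' ∈ N := by
    rintro a ha u u' (⟨-, rfl, -⟩ | ⟨-, rfl, -⟩)
    · exact Finset.mem_insert_of_mem (Finset.mem_union_right _
        (Finset.mem_image_of_mem _ (Finset.mem_range.2 ha)))
    · exact Finset.mem_insert_of_mem (Finset.mem_union_left _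
        (Finset.mem_image_of_mem _ (Finset.mem_range.2 ha)))
  have hqN : ∀ {reached parent queue : ℕ → ℕ} {n : ℕ},
      SearchInv m c r Arc reached parent queue n → ∀ i < n, queue i ∈ N := by
    intro reached parent queue n h i hi
    rcases Nat.eq_zero_or_pos i with rfl | hi0
    · rw [h.root]; exact Finset.mem_insert_self _ _
    · obtain ⟨h1, j, -, h2⟩ := h.tree i hi hi0
      exact hArcN _ h1 _ _ h2
  -- The potential of the loop is the total cost of the nodes that have not left the queue.
  let cost : ℕ → ℕ := fun u => scanCost 4 1 forwardTest * countBelow tl u m +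
    scanCost 6 0 backwardTest * countBelow hd u m + nodeCost
  have hcost : ∑ u ∈ N, cost u ≤ (scanCost 4 1 forwardTest + scanCost 6 0 backwardTest) * m +
      nodeCost * (2 * m + 1) := by
    simp only [cost, Finset.sum_add_distrib, ← Finset.mul_sum, Finset.sum_const, smul_eq_mul]
    have h1 := Nat.mul_le_mul_left (scanCost 4 1 forwardTest) (sum_countBelow_le (m := m) tl N)
    have h2 := Nat.mul_le_mul_left (scanCost 6 0 backwardTest) (sum_countBelow_le (m := m) hd N)
    have h3 := Nat.mul_le_mul_left nodeCost hNcard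
    linarith
  let I : State → Prop := fun s' =>
    SearchInv m c r Arc (s'.arr 9) (s'.arr 10) (s'.arr 11) (s'.var 7) ∧ s'.var 6 ≤ s'.var 7 ∧
    ∀ i < s'.var 6, ∀ a < m, ∀ u', Arc a (s'.arr 11 i) u' → s'.arr 9 u' = c
  let rest : State → Finset ℕ := fun s' => N \ (Finset.range (s'.var 6)).image (s'.arr 11)
  let Φ : State → ℕ := fun s' => ∑ u ∈ rest s', cost u
  refine (Terminates.seq (T := searchInit.bound)
    (T' := (scanCost 4 1 forwardTest + scanCost 6 0 backwardTest) * m +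
      nodeCost * (2 * m + 1) + (Test.lt front back).cost + 1)
    (terminates_of_loopFree rfl ?_)).mono ?_ fun s' hs' => hs'
  swap
  · unfold searchCost; nlinarith
  set s₁ := searchInit.exec w s with hs₁
  have h1 : s₁ = ⟨Function.update (Function.update s.var 6 0) 7 1,
      Function.update (Function.update s.arr 9 (Function.update (s.arr 9) r c))
        11 (Function.update (s.arr 11) 0 r)⟩ := by
    simp [hs₁, searchInit, Program.exec, Expr.eval, hr, hc]
  have hf1 : ∀ x, x ≠ 6 → x ≠ 7 → s₁.var x = s.var x := fun x h6 h7 => by simp [h1, h6, h7]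
  have ha1 : ∀ a, a < 9 → s₁.arr a = s.arr a := fun a ha => by
    have e9 : a ≠ 9 := by omega
    have e11 : a ≠ 11 := by omega
    simp [h1, e9, e11]
  have hI : I s₁ := by
    refine ⟨?_, by simp [h1], by simp [h1]⟩
    have := SearchInv.init (m := m) (Arc := Arc) (parent := s.arr 10)
      (queue := Function.update (s.arr 11) 0 r) hlt (Function.update_self _ _ _)
    simpa [h1] using this
  have hΦ : Φ s₁ ≤ (scanCost 4 1 forwardTest + scanCost 6 0 backwardTest) * m +
      nodeCost * (2 * m + 1) :=
    (Finset.sum_le_sum_of_subset Finset.sdiff_subset).trans hcost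
  refine (Terminates.loop I Φ hI ?_).mono (by omega) ?_
  · intro s₂ hf ⟨hinv, hle, hclosed⟩ hlt'
    replace hlt' : s₂.var 6 < s₂.var 7 := hlt'
    have hvar2 : ∀ x, x ≠ 6 → x ≠ 7 → x ≠ 8 → s₂.var x = s.var x := fun x h6 h7 h8 => by
      rw [hf.var x (by simp [searchStep, scan, scanStep, Program.assigns, h6, h7, h8]),
        hf1 x h6 h7]
    have harr2 : ∀ a < 9, s₂.arr a = s.arr a := fun a ha => by
      have e9 : a ≠ 9 := by omega
      have e10 : a ≠ 10 := by omega
      have e11 : a ≠ 11 := by omega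
      rw [hf.arr a (by simp [searchStep, scan, scanStep, Program.stores, e9, e10, e11]), ha1 a ha]
    have hs2 : HasLists m tl hd s₂ := hs.congr (hvar2 1 (by decide) (by decide) (by decide))
      fun a ha _ => harr2 a (by omega)
    have h42 : s₂.var 4 = c := hvar2 4 (by decide) (by decide) (by decide)
    have h52 : s₂.var 5 = s.var 5 := hvar2 5 (by decide) (by decide) (by decide)
    refine ⟨scanCost 4 1 forwardTest * countBelow tl (s₂.arr 11 (s₂.var 6)) m + scanInitCost 3 +
      (scanCost 6 0 backwardTest * countBelow hd (s₂.arr 11 (s₂.var 6)) m + scanInitCost 5 +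
        (Program.assign 6 (.succ front)).bound), Terminates.seq ?_⟩
    have hscan := terminates_scan (w := w) (s := s₂) (first := 3) (next := 4) (far := 1)
      (b := forwardTest) (key := tl) (El := fun a => X a ≠ v + 1 ∧ hd a ≠ v) (m := m) (r := r)
      (Arc := Arc) (by decide) (by decide) (by decide) hs2.firstOut hs2.nextOut
      (fun s' hv' ha' => by
        simp [forwardTest, Test.Holds, Expr.eval, hv' 5 (by decide) (by decide), ha' 8 (by decide),
          ha' 1 (by decide), hs2.head, h52, harr2 8 (by decide), hv, hX])
      (fun a _ hel => Or.inl ⟨rfl, by rw [hs2.head], hel.1, hel.2⟩)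
      (by rw [h42]; exact hinv) hlt'
    refine hscan.frame.mono le_rfl ?_
    rintro s₃ ⟨hf3, hinv3, hle3, hq3, hdone3⟩
    rw [h42] at hinv3 hdone3
    have hvar3 : ∀ x, x ≠ 7 → x ≠ 8 → s₃.var x = s₂.var x := fun x h7 h8 =>
      hf3.var x (by simp [scan, scanStep, Program.assigns, h7, h8])
    have harr3 : ∀ a < 9, s₃.arr a = s₂.arr a := fun a ha => by
      have e9 : a ≠ 9 := by omega
      have e10 : a ≠ 10 := by omega
      have e11 : a ≠ 11 := by omega
      exact hf3.arr a (by simp [scan, scanStep, Program.stores, e9, e10, e11])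
    have hs3 : HasLists m tl hd s₃ := hs2.congr (hvar3 1 (by decide) (by decide))
      fun a ha _ => harr3 a (by omega)
    have h43 : s₃.var 4 = c := (hvar3 4 (by decide) (by decide)).trans h42
    have h53 : s₃.var 5 = s.var 5 := (hvar3 5 (by decide) (by decide)).trans h52
    have h63 : s₃.var 6 = s₂.var 6 := hvar3 6 (by decide) (by decide)
    have hfront3 : s₃.arr 11 (s₃.var 6) = s₂.arr 11 (s₂.var 6) := by rw [h63, hq3 _ hlt']
    rw [← hfront3]
    refine Terminates.seq ?_
    have hscan := terminates_scan (w := w) (s := s₃) (first := 5) (next := 6) (far := 0)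
      (b := backwardTest) (key := hd) (El := fun a => X a = v + 1) (m := m) (r := r)
      (Arc := Arc) (by decide) (by decide) (by decide) hs3.firstIn hs3.nextIn
      (fun s' hv' ha' => by
        simp [backwardTest, Test.Holds, Expr.eval, hv' 5 (by decide) (by decide),
          ha' 8 (by decide), ha' 1 (by decide), hs3.head, h53, harr3 8 (by decide),
          harr2 8 (by decide), hv, hX])
      (fun a _ hel => Or.inr ⟨rfl, by rw [hs3.tail], hel⟩)
      (by rw [h43]; exact hinv3) (by omega)
    refine hscan.frame.mono le_rfl ?_
    rintro s₄ ⟨hf4, hinv4, hle4, hq4, hdone4⟩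
    rw [h43] at hinv4 hdone4
    have h64 : s₄.var 6 = s₂.var 6 := (hf4.var 6 (by decide)).trans h63
    refine terminates_of_loopFree rfl ?_
    have h5 : (Program.assign 6 (.succ front)).exec w s₄ =
        ⟨Function.update s₄.var 6 (s₂.var 6 + 1), s₄.arr⟩ := by
      simp [Program.exec, Expr.eval, h64]
    rw [h5]
    have hq24 : ∀ i < s₂.var 7, s₄.arr 11 i = s₂.arr 11 i := fun i hi =>
      (hq4 i (hi.trans_le hle3)).trans (hq3 i hi)
    refine ⟨⟨by simpa using hinv4, by simp; omega, fun i hi a ha u' harc => ?_⟩, ?_⟩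
    · simp only [Function.update_self] at hi
      simp only at harc ⊢
      rcases Nat.lt_succ_iff_lt_or_eq.1 hi with hi | rfl
      · rw [hq24 i (hi.trans hlt')] at harc
        exact hinv.reached_of_agree hinv4 (hle3.trans hle4) hq24 (hclosed i hi a ha u' harc)
      · rw [hq24 _ hlt'] at harc
        rcases harc with ⟨h1, rfl, h2, h3⟩ | ⟨h1, rfl, h2⟩
        · have := hdone3 a ha h1 ⟨h2, h3⟩
          rw [hs2.head] at this
          exact hinv3.reached_of_agree hinv4 hle4 hq4 this
        · have := hdone4 a ha (by rw [h1, hfront3]) h2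
          rwa [hs3.tail] at this
    · have hu : s₂.arr 11 (s₂.var 6) ∈ rest s₂ := by
        refine Finset.mem_sdiff.2 ⟨hqN hinv _ hlt', fun h' => ?_⟩
        obtain ⟨i, hi, hi'⟩ := Finset.mem_image.1 h'
        rw [Finset.mem_range] at hi
        have := hinv.inj i (hi.trans hlt') _ hlt' hi'
        omega
      have hrest : rest ⟨Function.update s₄.var 6 (s₂.var 6 + 1), s₄.arr⟩ =
          (rest s₂).erase (s₂.arr 11 (s₂.var 6)) := by
        simp only [rest, Function.update_self]
        rw [Finset.range_add_one, Finset.image_insert, hq24 _ hlt',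
          Finset.image_congr (g := s₂.arr 11) fun i hi => hq24 i ?_]
        · ext z
          simp only [Finset.mem_sdiff, Finset.mem_insert, Finset.mem_erase, not_or]
          tauto
        · have : i < s₂.var 6 := by simpa using hi
          omega
      have hsum := Finset.add_sum_erase (rest s₂) cost hu
      rw [← hrest] at hsum
      simp only [Φ, ← hsum, hfront3]
      simp only [cost, nodeCost]
      omega
  · rintro s' ⟨-, ⟨hinv, hle, hclosed⟩, hend⟩
    replace hend : ¬ s'.var 6 < s'.var 7 := hend
    refine ⟨hinv, ?_, fun a ha u u' harc hu => ?_⟩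
    · refine le_trans ?_ hNcard
      have h1 : (Finset.range (s'.var 7)).image (s'.arr 11) ⊆ N := by
        intro z hz
        obtain ⟨i, hi, rfl⟩ := Finset.mem_image.1 hz
        exact hqN hinv i (Finset.mem_range.1 hi)
      have h2 := Finset.card_le_card h1
      rwa [Finset.card_image_of_injOn, Finset.card_range] at h2
      intro i hi j hj hij
      exact hinv.inj i (by simpa using hi) j (by simpa using hj) hij
    · obtain ⟨i, hi, rfl⟩ := (hinv.reached_iff u).1 hu
      exact hclosed i (by omega) a ha u' harc

/-! ### Augmentation, selection of the next edge, and the construction of the lists -/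

/-- The time for one step of the augmentation, including the test of the loop. -/
def augmentCost : ℕ :=
  augmentStep.bound + (Test.not (.eq node root)).cost + 1

/-- The time that the augmentation takes in addition to its steps. -/
def augmentInitCost : ℕ :=
  (Program.seq (.store 2 edge (.const 1)) (.assign 9 (tailOf edge))).bound +
    (Test.not (.eq node root)).cost + 1

/-- The walk from the tail of the current edge back to the root. The relation `J` between labels
and the current node is preserved if each step along an arc, which ends at the current node and
starts at a reached node of smaller rank `pos`, preserves it. -/
theorem terminates_augment {pos : ℕ → ℕ} {J : (ℕ → ℕ) → ℕ → Prop} {c : ℕ}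
    (htl : s.arr 0 = tl) (hhd : s.arr 1 = hd)
    (hreached : s.arr 9 (tl (s.var 5)) = c) (hJ : J (s.arr 8) (tl (s.var 5)))
    (step : ∀ X y, s.arr 9 y = c → y ≠ s.var 2 → J X y → ∃ u, s.arr 9 u = c ∧ pos u < pos y ∧
      if X (s.arr 10 y) = hd (s.var 5) + 1
      then hd (s.arr 10 y) = u ∧ J (Function.update X (s.arr 10 y) 0) u
      else tl (s.arr 10 y) = u ∧ J (Function.update X (s.arr 10 y) (hd (s.var 5) + 1)) u) :
    Terminates w augment s (augmentCost * pos (tl (s.var 5)) + augmentInitCost) fun s' =>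
      s'.arr 2 = Function.update (s.arr 2) (s.var 5) 1 ∧ J (s'.arr 8) (s.var 2) := by
  set s₁ := (Program.seq (.store 2 edge (.const 1)) (.assign 9 (tailOf edge))).exec w s with hs₁
  have h1 : s₁ = ⟨Function.update s.var 9 (tl (s.var 5)),
      Function.update s.arr 2 (Function.update (s.arr 2) (s.var 5) 1)⟩ := by
    simp [hs₁, Program.exec, Expr.eval, htl]
  let I : State → Prop := fun s' => s.arr 9 (s'.var 9) = c ∧ J (s'.arr 8) (s'.var 9)
  let Φ : State → ℕ := fun s' => augmentCost * pos (s'.var 9)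
  have hI : I s₁ := by simpa [I, h1] using ⟨hreached, hJ⟩
  have hΦ : Φ s₁ = augmentCost * pos (tl (s.var 5)) := by simp [Φ, h1]
  refine (Terminates.seq (terminates_of_loopFree rfl
    ((Terminates.loop (s := s₁) I Φ hI ?_).mono le_rfl ?_))).mono
      (by rw [hΦ]; unfold augmentInitCost; omega) fun s' hs' => hs'
  · intro s₂ hf ⟨hr, hJ2⟩ hne
    have hvar : ∀ x, x ≠ 9 → s₂.var x = s.var x := fun x hx => by
      rw [hf.var x (by simp [augmentStep, Program.assigns, hx]), h1]
      simp [hx]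
    have harr : ∀ a, a ≠ 2 → a ≠ 8 → s₂.arr a = s.arr a := fun a h2 h8 => by
      rw [hf.arr a (by simp [augmentStep, Program.stores, h8]), h1]
      simp [h2]
    have hy : s₂.var 9 ≠ s.var 2 := by
      simpa [Test.Holds, Expr.eval, hvar 2 (by decide)] using hne
    obtain ⟨u, hu, hpos, hstep⟩ := step (s₂.arr 8) (s₂.var 9) hr hy hJ2
    have hpay : augmentStep.bound + (Test.not (.eq node root)).cost + 1 + augmentCost * pos u ≤
        augmentCost * pos (s₂.var 9) := by
      have := Nat.mul_le_mul_left augmentCost hpos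
      rw [Nat.mul_succ] at this
      unfold augmentCost at *
      omega
    refine ⟨augmentStep.bound, terminates_of_loopFree rfl ?_⟩
    have h0 : s₂.arr 0 = tl := (harr 0 (by decide) (by decide)).trans htl
    have h1' : s₂.arr 1 = hd := (harr 1 (by decide) (by decide)).trans hhd
    have h10 : s₂.arr 10 = s.arr 10 := harr 10 (by decide) (by decide)
    have h5 : s₂.var 5 = s.var 5 := hvar 5 (by decide)
    by_cases hlab : s₂.arr 8 (s.arr 10 (s₂.var 9)) = hd (s.var 5) + 1
    · rw [if_pos hlab] at hstep
      have : augmentStep.exec w s₂ = ⟨Function.update s₂.var 9 u, Function.update s₂.arr 8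
          (Function.update (s₂.arr 8) (s.arr 10 (s₂.var 9)) 0)⟩ := by
        simp [augmentStep, Program.exec, Expr.eval, Test.Holds, h10, h1', h5, hlab, hstep.1]
      rw [this]
      simpa [I, Φ] using ⟨⟨hu, hstep.2⟩, hpay⟩
    · rw [if_neg hlab] at hstep
      have : augmentStep.exec w s₂ = ⟨Function.update s₂.var 9 u, Function.update s₂.arr 8
          (Function.update (s₂.arr 8) (s.arr 10 (s₂.var 9)) (hd (s.var 5) + 1))⟩ := by
        simp [augmentStep, Program.exec, Expr.eval, Test.Holds, h10, h0, h1', h5, hlab, hstep.1]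
      rw [this]
      simpa [I, Φ] using ⟨⟨hu, hstep.2⟩, hpay⟩
  · rintro s' ⟨hf, ⟨-, hJ'⟩, hend⟩
    have h2 : s'.var 2 = s.var 2 := by rw [hf.var 2 (by decide), h1]; simp
    have h9 : s'.var 9 = s.var 2 := by
      simpa [Test.Holds, Expr.eval, h2] using hend
    refine ⟨?_, by rwa [h9] at hJ'⟩
    rw [hf.arr 2 (by decide), h1]; simp

/-- The time for one step of the selection, including the test of the loop. -/
def selectCost : ℕ := selectStep.bound + (Test.lt counter edgeCount).cost + 1

/-- The time that the selection takes in addition to its steps. -/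
def selectInitCost : ℕ :=
  (Program.seq (.assign 5 (.const 0)) (.assign 3 (.const 0))).bound +
    (Test.lt counter edgeCount).cost + 1

/-- The order by head and weight in which the edges are processed. -/
def Precedes (w : ℕ → ℚ≥0) (hd : ℕ → ℕ) (a b : ℕ) : Prop :=
  hd a < hd b ∨ (hd a = hd b ∧ w a ≤ w b)

theorem Precedes.refl (a : ℕ) : Precedes w hd a a := Or.inr ⟨rfl, le_rfl⟩

theorem Precedes.trans {a b c : ℕ} (h : Precedes w hd a b) (h' : Precedes w hd b c) :
    Precedes w hd a c := by
  rcases h with h | ⟨h1, h2⟩ <;> rcases h' with h' | ⟨h1', h2'⟩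
  · exact Or.inl (h.trans h')
  · exact Or.inl (h1' ▸ h)
  · exact Or.inl (h1 ▸ h')
  · exact Or.inr ⟨h1.trans h1', h2.trans h2'⟩

theorem Precedes.of_not {a b : ℕ} (h : ¬ Precedes w hd a b) : Precedes w hd b a := by
  unfold Precedes at *
  rcases lt_trichotomy (hd a) (hd b) with h1 | h1 | h1
  · exact absurd (Or.inl h1) h
  · exact Or.inr ⟨h1.symm, (le_total (w a) (w b)).resolve_left fun h2 => h (Or.inr ⟨h1, h2⟩)⟩
  · exact Or.inl h1

/-- The second alternative of the invariant is the case in which the initial choice, the edge `0`,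
and all edges that have been compared with it have been processed before. -/
theorem terminates_select (hm : s.var 1 = m) (hhd : s.arr 1 = hd)
    (hex : ∃ a < m, s.arr 7 a = 0) :
    Terminates w select s (selectCost * m + selectInitCost) fun s' =>
      s'.var 5 < m ∧ s.arr 7 (s'.var 5) = 0 ∧
      ∀ a < m, s.arr 7 a = 0 → Precedes w hd (s'.var 5) a := by
  obtain ⟨a₀, ha₀, hdone₀⟩ := hex
  set s₁ := (Program.seq (.assign 5 (.const 0)) (.assign 3 (.const 0))).exec w s with hs₁
  have h1 : s₁ = ⟨Function.update (Function.update s.var 5 0) 3 0, s.arr⟩ := by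
    simp [hs₁, Program.exec, Expr.eval]
  let I : State → Prop := fun s' => s'.var 3 ≤ m ∧ s'.var 5 < m ∧
    ((s.arr 7 (s'.var 5) = 0 ∧ ∀ a < s'.var 3, s.arr 7 a = 0 → Precedes w hd (s'.var 5) a) ∨
      (s.arr 7 (s'.var 5) ≠ 0 ∧ ∀ a < s'.var 3, s.arr 7 a ≠ 0))
  let Φ : State → ℕ := fun s' => selectCost * (m - s'.var 3)
  have hI : I s₁ := by
    refine ⟨by simp [h1], by simp [h1]; omega, ?_⟩
    by_cases h0 : s.arr 7 0 = 0
    · exact Or.inl (by simp [h1, h0])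
    · exact Or.inr (by simp [h1, h0])
  have hΦ : Φ s₁ = selectCost * m := by simp [Φ, h1]
  refine (Terminates.seq (terminates_of_loopFree rfl
    ((Terminates.loop (s := s₁) I Φ hI ?_).mono le_rfl ?_))).mono
      (by rw [hΦ]; unfold selectInitCost; omega) fun s' hs' => hs'
  · intro s₂ hf ⟨hle, he, hinv⟩ hlt
    have harr : s₂.arr = s.arr := by
      funext a
      rw [hf.arr a (by simp [selectStep, Program.stores]), h1]
    have h12 : s₂.var 1 = m := by
      rw [hf.var 1 (by decide), h1]; simpa using hm
    replace hlt : s₂.var 3 < s₂.var 1 := hlt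
    rw [h12] at hlt
    refine ⟨selectStep.bound, terminates_of_loopFree rfl ?_⟩
    have htest : (Test.and (.eq (isDone counter) (.const 0)) preferred).Holds w s₂ ↔
        s.arr 7 (s₂.var 3) = 0 ∧ (s.arr 7 (s₂.var 5) = 0 →
          Precedes w hd (s₂.var 3) (s₂.var 5)) := by
      simp only [preferred, Test.Holds, Expr.eval, harr, hhd, Precedes]
      tauto
    have hpay : selectStep.bound + (Test.lt counter edgeCount).cost + 1 +
        selectCost * (m - (s₂.var 3 + 1)) ≤ selectCost * (m - s₂.var 3) := by
      obtain ⟨k, hk⟩ := Nat.exists_eq_add_of_lt hlt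
      rw [hk, show s₂.var 3 + k + 1 - (s₂.var 3 + 1) = k by omega,
        show s₂.var 3 + k + 1 - s₂.var 3 = k + 1 by omega, Nat.mul_succ]
      unfold selectCost
      omega
    by_cases htst : (Test.and (.eq (isDone counter) (.const 0)) preferred).Holds w s₂
    · have : selectStep.exec w s₂ =
          ⟨Function.update (Function.update s₂.var 5 (s₂.var 3)) 3 (s₂.var 3 + 1), s₂.arr⟩ := by
        simp only [selectStep, Program.exec, if_pos htst]
        simp [Expr.eval]
      rw [this]
      obtain ⟨h3, hpre⟩ := htest.1 htst
      refine ⟨⟨by simp; omega, by simpa using hlt, Or.inl ?_⟩, by simpa [Φ] using hpay⟩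
      simp only [Function.update_self, ne_eq, Nat.reduceEqDiff, not_false_eq_true,
        Function.update_of_ne]
      refine ⟨h3, fun a ha hda => ?_⟩
      rcases Nat.lt_succ_iff_lt_or_eq.1 ha with ha | rfl
      · rcases hinv with ⟨h5, hmin⟩ | ⟨-, hmin⟩
        · exact (hpre h5).trans (hmin a ha hda)
        · exact absurd hda (hmin a ha)
      · exact Precedes.refl _
    · have : selectStep.exec w s₂ =
          ⟨Function.update s₂.var 3 (s₂.var 3 + 1), s₂.arr⟩ := by
        simp only [selectStep, Program.exec, if_neg htst]
        simp [Expr.eval]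
      rw [this]
      rw [htest, not_and] at htst
      refine ⟨⟨by simp; omega, by simpa using he, ?_⟩, by simpa [Φ] using hpay⟩
      simp only [Function.update_self, ne_eq, Nat.reduceEqDiff, not_false_eq_true,
        Function.update_of_ne]
      rcases hinv with ⟨h5, hmin⟩ | ⟨h5, hmin⟩
      · refine Or.inl ⟨h5, fun a ha hda => ?_⟩
        rcases Nat.lt_succ_iff_lt_or_eq.1 ha with ha | rfl
        · exact hmin a ha hda
        · exact Precedes.of_not fun h => htst hda fun _ => h
      · refine Or.inr ⟨h5, fun a ha hda => ?_⟩
        rcases Nat.lt_succ_iff_lt_or_eq.1 ha with ha | rfl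
        · exact hmin a ha hda
        · exact htst hda fun h => absurd h h5
  · rintro s' ⟨hf, ⟨hle, he, hinv⟩, hend⟩
    have h12 : s'.var 1 = m := by
      rw [hf.var 1 (by decide), h1]; simpa using hm
    replace hend : ¬ s'.var 3 < s'.var 1 := hend
    rw [h12] at hend
    rcases hinv with ⟨h5, hmin⟩ | ⟨-, hmin⟩
    · exact ⟨he, h5, fun a ha hda => hmin a (by omega) hda⟩
    · exact absurd hdone₀ (hmin a₀ (by omega))

/-- The time for one step of the construction of the lists, including the test of the loop. -/
def buildCost : ℕ := buildStep.bound + (Test.lt counter edgeCount).cost + 1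

/-- The edges are inserted in increasing order at the front of the lists, so the first edge of a
list is always the one with the largest number. -/
theorem terminates_build (hm : s.var 1 = m) (h3 : s.var 3 = 0) (htl : s.arr 0 = tl)
    (hhd : s.arr 1 = hd) (hout : ∀ u, s.arr 3 u = 0) (hin : ∀ u, s.arr 5 u = 0) :
    Terminates w build s (buildCost * (m + 1)) (HasLists m tl hd) := by
  let I : State → Prop := fun s' => s'.var 3 ≤ m ∧
    (∀ u, s'.arr 3 u = lastPtr tl u (s'.var 3)) ∧
    (∀ a < s'.var 3, s'.arr 4 a = lastPtr tl (tl a) a) ∧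
    (∀ u, s'.arr 5 u = lastPtr hd u (s'.var 3)) ∧
    (∀ a < s'.var 3, s'.arr 6 a = lastPtr hd (hd a) a)
  let Φ : State → ℕ := fun s' => buildCost * (m - s'.var 3)
  have hI : I s := by simp [I, h3, hout, hin, lastPtr]
  have hΦ : Φ s = buildCost * m := by simp [Φ, h3]
  refine (Terminates.loop I Φ hI ?_).mono (by rw [hΦ, buildCost, Nat.mul_succ]; omega) ?_
  · intro s₂ hf ⟨hle, hfo, hno, hfi, hni⟩ hlt
    have h12 : s₂.var 1 = m := (hf.var 1 (by decide)).trans hm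
    have h02 : s₂.arr 0 = tl := (hf.arr 0 (by decide)).trans htl
    have hh2 : s₂.arr 1 = hd := (hf.arr 1 (by decide)).trans hhd
    replace hlt : s₂.var 3 < s₂.var 1 := hlt
    rw [h12] at hlt
    refine ⟨buildStep.bound, terminates_of_loopFree rfl ?_⟩
    set k := s₂.var 3 with hk
    have hex : buildStep.exec w s₂ = ⟨Function.update s₂.var 3 (k + 1),
        Function.update (Function.update (Function.update (Function.update s₂.arr
          4 (Function.update (s₂.arr 4) k (lastPtr tl (tl k) k)))
          3 (Function.update (s₂.arr 3) (tl k) (k + 1)))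
          6 (Function.update (s₂.arr 6) k (lastPtr hd (hd k) k)))
          5 (Function.update (s₂.arr 5) (hd k) (k + 1))⟩ := by
      simp [buildStep, Program.exec, Expr.eval, h02, hh2, hfo, hfi, ← hk]
    have hfirst : ∀ (key first : ℕ → ℕ), (∀ u, first u = lastPtr key u k) → ∀ u,
        Function.update first (key k) (k + 1) u = lastPtr key u (k + 1) := by
      intro key first h u
      by_cases hu : u = key k
      · subst hu; simp [lastPtr]
      · simp [lastPtr, hu, Ne.symm hu, h]
    have hnext : ∀ (key next : ℕ → ℕ), (∀ a < k, next a = lastPtr key (key a) a) →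
        ∀ a < k + 1, Function.update next k (lastPtr key (key k) k) a =
          lastPtr key (key a) a := by
      intro key next h a ha
      rcases Nat.lt_succ_iff_lt_or_eq.1 ha with ha | rfl
      · rw [Function.update_of_ne ha.ne, h a ha]
      · rw [Function.update_self]
    rw [hex]
    refine ⟨⟨by simp; omega, ?_, ?_, ?_, ?_⟩, ?_⟩
    · simpa using hfirst tl _ hfo
    · simpa using hnext tl _ hno
    · simpa using hfirst hd _ hfi
    · simpa using hnext hd _ hni
    · simp only [Φ, Function.update_self, ← hk]
      obtain ⟨j, hj⟩ := Nat.exists_eq_add_of_lt hlt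
      rw [hj, show k + j + 1 - (k + 1) = j by omega, show k + j + 1 - k = j + 1 by omega,
        Nat.mul_succ]
      unfold buildCost
      omega
  · rintro s' ⟨hf, ⟨hle, hfo, hno, hfi, hni⟩, hend⟩
    have h12 : s'.var 1 = m := (hf.var 1 (by decide)).trans hm
    replace hend : ¬ s'.var 3 < s'.var 1 := hend
    have hkm : s'.var 3 = m := by omega
    rw [hkm] at hfo hno hfi hni
    exact ⟨h12, (hf.arr 0 (by decide)).trans htl, (hf.arr 1 (by decide)).trans hhd,
      hfo, hno, hfi, hni⟩

end Flame

end RAM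

/-! ### The invariant of the algorithm -/

namespace RAM

namespace Flame

open RootedDigraph

theorem ofFin_val {α : Type*} [Zero α] {m : ℕ} (f : Fin m → α) (i : Fin m) :
    ofFin f (i : ℕ) = f i := by
  simp [ofFin]

variable {n m : ℕ} {D : RootedDigraph (Fin n) (Fin m)} {w : Fin m → ℚ≥0}

/-- Array 0 of the input: the tails of the edges. -/
abbrev tailArray (D : RootedDigraph (Fin n) (Fin m)) : ℕ → ℕ := ofFin fun e => (D.tail e : ℕ)

/-- Array 1 of the input: the heads of the edges. -/
abbrev headArray (D : RootedDigraph (Fin n) (Fin m)) : ℕ → ℕ := ofFin fun e => (D.head e : ℕ)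

/-- The flow that the labels encode for the node `v`. -/
def flowSet (m : ℕ) (label : ℕ → ℕ) (v : ℕ) : Finset (Fin m) :=
  Finset.univ.filter fun e => label e = v + 1

theorem mem_flowSet {label : ℕ → ℕ} {v : ℕ} {e : Fin m} :
    e ∈ flowSet m label v ↔ label e = v + 1 := by
  simp [flowSet]

theorem flowSet_update_self (label : ℕ → ℕ) (v : ℕ) (e : Fin m) :
    flowSet m (Function.update label e (v + 1)) v = insert e (flowSet m label v) := by
  ext f
  rw [Finset.mem_insert, mem_flowSet, mem_flowSet]
  by_cases hf : f = e
  · simp [hf]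
  · have : (f : ℕ) ≠ e := fun h => hf (Fin.ext h)
    simp [hf, this]

theorem flowSet_update_zero (label : ℕ → ℕ) (v : ℕ) (e : Fin m) :
    flowSet m (Function.update label e 0) v = (flowSet m label v).erase e := by
  ext f
  rw [Finset.mem_erase, mem_flowSet, mem_flowSet]
  by_cases hf : f = e
  · simp [hf]
  · have : (f : ℕ) ≠ e := fun h => hf (Fin.ext h)
    simp [hf, this]

variable (D w) in
/-- The invariant of the main loop: the edges of `P` have been processed and those of `I` have been
accepted. For the one node whose edges may have been processed only in part, the labels hold
the flow; nodes whose turn has not yet come have no labels. -/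
structure GreedyInv (P I : Finset (Fin m)) (label : ℕ → ℕ) : Prop where
  order : ∀ d ∈ P, ∀ e ∉ P, Precedes (ofFin w) (headArray D) d e
  label_eq : ∀ e : Fin m, label e ≠ 0 → ∃ d ∈ P, label e = D.head d + 1
  head_ne_root : ∀ e ∈ I, D.head e ≠ D.root
  greedy : ∀ v, v ≠ D.root → ∃ x, D.IsGreedyState w v (D.inEdges P v) (D.inEdges I v) x ∧
    ((∃ e ∉ P, D.head e = v) → x = flowSet m label v)

theorem GreedyInv.init : GreedyInv D w ∅ ∅ fun _ => 0 where
  order := by simp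
  label_eq := by simp
  head_ne_root := by simp
  greedy v _ := ⟨∅, by simpa [inEdges] using IsGreedyState.empty D w v, fun _ => by simp [flowSet]⟩

/-- To process the next edge `e`, only the data for its head need attention: the labels of the
nodes that come later are empty before and after this. -/
theorem GreedyInv.insert {P I I' : Finset (Fin m)} {label label' : ℕ → ℕ}
    (h : GreedyInv D w P I label) {e : Fin m} (heP : e ∉ P)
    (hmin : ∀ f ∉ P, Precedes (ofFin w) (headArray D) e f)
    (hlabel : ∀ a, label' a = label a ∨ label' a = 0 ∨ label' a = D.head e + 1)
    (hI : I ⊆ I') (hI' : ∀ f ∈ I', f ∈ I ∨ f = e ∧ D.head e ≠ D.root)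
    (hgreedy : D.head e ≠ D.root → D.IsGreedyState w (D.head e)
      (insert e (D.inEdges P (D.head e))) (D.inEdges I' (D.head e))
      (flowSet m label' (D.head e))) :
    GreedyInv D w (insert e P) I' label' := by
  have hle : ∀ {a b : Fin m}, Precedes (ofFin w) (headArray D) a b →
      (D.head a : ℕ) ≤ D.head b := by
    rintro a b (h | ⟨h, -⟩) <;> rw [headArray, ofFin_val, ofFin_val] at h <;> omega
  refine ⟨fun d hd f hf => ?_, fun a ha => ?_, fun f hf => ?_, fun v hv => ?_⟩
  · rw [Finset.mem_insert, not_or] at hf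
    rcases Finset.mem_insert.1 hd with rfl | hd
    · exact hmin f hf.2
    · exact h.order d hd f hf.2
  · rcases hlabel a with h1 | h1 | h1
    · rw [h1] at ha ⊢
      obtain ⟨d, hd, hd'⟩ := h.label_eq a ha
      exact ⟨d, Finset.mem_insert_of_mem hd, hd'⟩
    · exact absurd h1 ha
    · exact ⟨e, Finset.mem_insert_self _ _, h1⟩
  · rcases hI' f hf with hf | ⟨rfl, hf⟩
    · exact h.head_ne_root f hf
    · exact hf
  · by_cases hev : D.head e = v
    · subst hev
      refine ⟨_, ?_, fun _ => rfl⟩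
      rw [inEdges, Finset.filter_insert, if_pos rfl]
      exact hgreedy hv
    · obtain ⟨x, hx, hxl⟩ := h.greedy v hv
      have h1 : D.inEdges (Insert.insert e P) v = D.inEdges P v := by
        rw [inEdges, Finset.filter_insert, if_neg hev]; rfl
      have h2 : D.inEdges I' v = D.inEdges I v := by
        ext f
        simp only [inEdges, Finset.mem_filter]
        refine and_congr_left fun hfv => ⟨fun hf => (hI' f hf).resolve_right ?_, fun hf => hI hf⟩
        rintro ⟨rfl, -⟩
        exact hev hfv
      refine ⟨x, by rwa [h1, h2], ?_⟩
      rintro ⟨f, hf, hfv⟩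
      rw [Finset.mem_insert, not_or] at hf
      rw [hxl ⟨f, hf.2, hfv⟩]
      have h3 := hle (hmin f hf.2)
      have h4 : (D.head e : ℕ) ≠ v := fun h' => hev (Fin.ext h')
      rw [hfv] at h3
      -- The order has not yet reached `v`, so `v + 1` occurs neither in `label` nor in `label'`.
      have hempty : ∀ a : Fin m, label a ≠ v + 1 := by
        intro a ha
        obtain ⟨d, hd, hd'⟩ := h.label_eq a (by omega)
        have := hle (h.order d hd e heP)
        omega
      ext a
      rw [mem_flowSet, mem_flowSet]
      refine iff_of_false (hempty a) fun ha => ?_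
      rcases hlabel a with h5 | h5 | h5
      · exact hempty a (h5 ▸ ha)
      · omega
      · omega

theorem GreedyInv.weight_le {P I : Finset (Fin m)} {label : ℕ → ℕ}
    (h : GreedyInv D w P I label) {e : Fin m} (heP : e ∉ P) :
    ∀ d ∈ D.inEdges P (D.head e), w d ≤ w e := by
  intro d hd
  obtain ⟨hdP, hde⟩ := Finset.mem_filter.1 hd
  rcases h.order d hdP e heP with h1 | ⟨-, h1⟩
  · rw [headArray, ofFin_val, ofFin_val, hde] at h1
    exact absurd h1 (lt_irrefl _)
  · rwa [ofFin_val, ofFin_val] at h1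

/-- The labels hold the flow for the head of every unprocessed edge. -/
theorem GreedyInv.isGreedyState {P I : Finset (Fin m)} {label : ℕ → ℕ}
    (h : GreedyInv D w P I label) {e : Fin m} (heP : e ∉ P) (her : D.head e ≠ D.root) :
    D.IsGreedyState w (D.head e) (D.inEdges P (D.head e)) (D.inEdges I (D.head e))
      (flowSet m label (D.head e)) := by
  obtain ⟨x, hx, hxl⟩ := h.greedy _ her
  rwa [hxl ⟨e, heP, rfl⟩] at hx

/-! ### Correctness of the rounds -/

variable {s : State}

theorem residualArc_iff {label : ℕ → ℕ} {v : ℕ} {e : Fin m} {u u' : ℕ} :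
    ResidualArc (tailArray D) (headArray D) label v e u u' ↔
      (label e = v + 1 ∨ (D.head e : ℕ) ≠ v) ∧
      (D.arcTail (flowSet m label v) e : ℕ) = u ∧ (D.arcHead (flowSet m label v) e : ℕ) = u' := by
  simp only [ResidualArc, tailArray, headArray, ofFin_val, arcTail, arcHead, mem_flowSet]
  by_cases h : label e = v + 1
  · simp [h]
  · simp [h]; tauto

/-- One step of the program `augment` performs one step of the augmentation of the flow. -/
theorem exists_augment_step {label : ℕ → ℕ} {v t : Fin n} {pos : ℕ → ℕ} {X : ℕ → ℕ}
    {u : Fin n} {e : Fin m} {u' : ℕ}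
    (harc : ResidualArc (tailArray D) (headArray D) label v e u' u) (hpos : pos u' < pos u)
    (hX : flowSet m X v ⊆ D.avoiding v)
    (hlabel : ∀ a, X a = label a ∨ X a = 0 ∨ X a = v + 1)
    (haug : D.IsPartialAugment (flowSet m label v) (flowSet m X v) (fun z => pos z) t u) :
    ∃ z : Fin n, (z : ℕ) = u' ∧ ∃ c : ℕ, (if X e = (v : ℕ) + 1
      then headArray D e = u' ∧ c = 0 else tailArray D e = u' ∧ c = (v : ℕ) + 1) ∧
      flowSet m (Function.update X e c) v ⊆ D.avoiding v ∧
      (∀ a, Function.update X e c a = label a ∨ Function.update X e c a = 0 ∨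
        Function.update X e c a = v + 1) ∧
      D.IsPartialAugment (flowSet m label v) (flowSet m (Function.update X e c) v)
        (fun z => pos z) t z := by
  obtain ⟨hav, rfl, hhead⟩ := residualArc_iff.1 harc
  obtain rfl := Fin.ext hhead
  have hmem := haug.mem_iff
  have hstep := haug.step hpos
  refine ⟨_, rfl, ?_⟩
  by_cases he : e ∈ flowSet m label v
  · rw [if_pos he] at hstep
    have hXe : X e = v + 1 := mem_flowSet.1 (hmem.2 he)
    refine ⟨0, ?_, ?_, fun a => ?_, ?_⟩
    · rw [if_pos hXe, headArray, ofFin_val, arcTail, if_pos he]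
      exact ⟨rfl, rfl⟩
    · rw [flowSet_update_zero]
      exact (Finset.erase_subset _ _).trans hX
    · by_cases ha : a = e
      · simp [ha]
      · simpa [ha] using hlabel a
    · rwa [flowSet_update_zero]
  · rw [if_neg he] at hstep
    have hXe : X e ≠ v + 1 := fun h' => he (hmem.1 (mem_flowSet.2 h'))
    refine ⟨v + 1, ?_, ?_, fun a => ?_, ?_⟩
    · rw [if_neg hXe, tailArray, ofFin_val, arcTail, if_neg he]
      exact ⟨rfl, rfl⟩
    · rw [flowSet_update_self]
      refine Finset.insert_subset ?_ hX
      have := hav.resolve_left fun h' => he (mem_flowSet.2 h')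
      simpa [avoiding, Fin.ext_iff] using this
    · by_cases ha : a = e
      · simp [ha]
      · simpa [ha] using hlabel a
    · rwa [flowSet_update_self]

/-- The coefficient of the linear time bound for testing one edge. -/
def processCost : ℕ :=
  (Test.eq (headOf edge) root).cost + searchCost +
    (Test.eq (reached (tailOf edge)) round).cost + 2 * augmentCost + augmentInitCost + 10

/-- The relation preserved by the augmentation says that the labels encode a partial augmentation of
the old flow, in the sense of `IsPartialAugment`, and that only labels `0` and `v + 1` have been
written. If the tail of `e` is not reached, then the reached nodes form the closed set needed for
`IsGreedyState.reject`. -/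
theorem terminates_processEdge (hs : HasLists m (tailArray D) (headArray D) s)
    (hroot : s.var 2 = D.root) (hlt : ∀ u, s.arr 9 u < s.var 4) {e : Fin m} (he : s.var 5 = e)
    {P : Finset (Fin m)} (hinv : GreedyInv D w P (outputSet m s) (s.arr 8)) (heP : e ∉ P)
    (hmin : ∀ f ∉ P, Precedes (ofFin w) (headArray D) e f) :
    Terminates (ofFin w) processEdge s (processCost * (m + 1)) fun s' =>
      (∀ u, s'.arr 9 u ≤ s.var 4) ∧
      GreedyInv D w (insert e P) (outputSet m s') (s'.arr 8) := by
  have hhe : headArray D (s.var 5) = D.head e := by rw [he, headArray, ofFin_val]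
  have hte : tailArray D (s.var 5) = D.tail e := by rw [he, tailArray, ofFin_val]
  set v := D.head e with hv
  have hheP : e ∉ D.inEdges P v := fun h => heP (Finset.mem_filter.1 h).1
  refine (Terminates.branch (T := searchCost * (m + 1) +
    ((Test.eq (reached (tailOf edge)) round).cost +
      (augmentCost * (2 * m + 1) + augmentInitCost + 1) + 1)) (fun hr => ?_) fun hr => ?_).mono ?_
      fun s' hs' => hs'
  · refine ⟨s, 1, .skip s, by omega, fun u => (hlt u).le, ?_⟩
    have hr' : D.head e = D.root := by
      have : s.arr 1 (s.var 5) = s.var 2 := hr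
      rw [hs.head, hhe, hroot] at this
      exact Fin.ext this
    exact hinv.insert heP hmin (fun a => Or.inl rfl) subset_rfl (fun f hf => Or.inl hf)
      fun h => absurd hr' h
  · have hr' : D.head e ≠ D.root := by
      intro h
      refine hr ?_
      change s.arr 1 (s.var 5) = s.var 2
      rw [hs.head, hhe, hroot, hv, h]
    have hg := hinv.isGreedyState heP hr'
    rw [← hv] at hg
    refine Terminates.seq ((terminates_search hs hlt).frame.mono le_rfl ?_)
    rintro s₁ ⟨hf, hsearch, hback, hclosed⟩
    rw [hhe] at hsearch hclosed
    have hvar1 : ∀ x < 6, s₁.var x = s.var x := fun x hx => by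
      have e6 : x ≠ 6 := by omega
      have e7 : x ≠ 7 := by omega
      have e8 : x ≠ 8 := by omega
      exact hf.var x (by simp [search, searchInit, searchStep, scan, scanStep, Program.assigns,
        e6, e7, e8])
    have harr1 : ∀ a < 9, s₁.arr a = s.arr a := fun a ha => by
      have e9 : a ≠ 9 := by omega
      have e10 : a ≠ 10 := by omega
      have e11 : a ≠ 11 := by omega
      exact hf.arr a (by simp [search, searchInit, searchStep, scan, scanStep, Program.stores,
        e9, e10, e11])
    have h4 := hvar1 4 (by decide)
    have h5 := hvar1 5 (by decide)
    have h8 := harr1 8 (by decide)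
    have h0 : s₁.arr 0 = tailArray D := (harr1 0 (by decide)).trans hs.tail
    have h1 : s₁.arr 1 = headArray D := (harr1 1 (by decide)).trans hs.head
    have hout1 : outputSet m s₁ = outputSet m s := by
      unfold outputSet; rw [harr1 2 (by decide)]
    refine Terminates.branch (fun ht => ?_) fun ht => ?_
    · have ht' : s₁.arr 9 (D.tail e) = s.var 4 := by
        have : s₁.arr 9 (s₁.arr 0 (s₁.var 5)) = s₁.var 4 := ht
        rwa [h0, h5, hte, h4] at this
      obtain ⟨pos, hposlt, hrank⟩ := hsearch.exists_rank
      let J : (ℕ → ℕ) → ℕ → Prop := fun X y => ∃ u : Fin n, (u : ℕ) = y ∧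
        flowSet m X v ⊆ D.avoiding v ∧ (∀ a, X a = s.arr 8 a ∨ X a = 0 ∨ X a = v + 1) ∧
        D.IsPartialAugment (flowSet m (s.arr 8) v) (flowSet m X v) (fun z => pos z) (D.tail e) u
      have hJ : J (s₁.arr 8) (tailArray D (s₁.var 5)) := by
        refine ⟨D.tail e, by rw [h5, hte], ?_, fun a => Or.inl (by rw [h8]), ?_⟩
        · rw [h8]; exact hg.supplies.subset
        · rw [h8]; exact IsPartialAugment.refl _ _ _ _
      refine ((terminates_augment (pos := pos) (J := J) h0 h1 (by rw [h5, hte, ht']) hJ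
        ?_).frame).mono ?_ ?_
      · rintro X _ hy hyr ⟨u, rfl, hXA, hlab, haug⟩
        rw [hvar1 2 (by decide)] at hyr
        obtain ⟨hpm, u', hu', hpos', harc⟩ := hrank u hy hyr
        refine ⟨u', hu', hpos', ?_⟩
        rw [h5, hhe]
        obtain ⟨z, hz, c, hif, h6⟩ := exists_augment_step (e := ⟨s₁.arr 10 u, hpm⟩)
          harc hpos' hXA hlab haug
        simp only at hif h6
        split_ifs at hif ⊢ with hc
        · obtain ⟨h7, rfl⟩ := hif
          exact ⟨h7, z, hz, h6⟩
        · obtain ⟨h7, rfl⟩ := hif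
          exact ⟨h7, z, hz, h6⟩
      · have := hposlt _ ht'
        rw [h5, hte]
        have := Nat.mul_le_mul_left augmentCost (show pos (D.tail e) ≤ 2 * m + 1 by omega)
        omega
      · rintro s₂ ⟨hf2, hs2, u, hu, hXA, hlab, haug⟩
        rw [hvar1 2 (by decide), hroot] at hu
        obtain rfl := Fin.ext hu
        refine ⟨fun z => ?_, ?_⟩
        · rw [hf2.arr 9 (by decide)]; exact hsearch.le z
        have hout : outputSet m s₂ = insert e (outputSet m s) := by
          ext f
          simp only [outputSet, Finset.mem_filter, Finset.mem_univ, true_and, Finset.mem_insert,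
            hs2, h5, he, harr1 2 (by decide)]
          by_cases hfe : f = e
          · simp [hfe]
          · have : (f : ℕ) ≠ e := fun h => hfe (Fin.ext h)
            simp [hfe, this]
        rw [hout]
        refine hinv.insert heP hmin hlab (Finset.subset_insert _ _) (fun f hf => ?_) fun _ => ?_
        · rcases Finset.mem_insert.1 hf with rfl | hf
          · exact Or.inr ⟨rfl, hr'⟩
          · exact Or.inl hf
        · rw [← hv, show D.inEdges (insert e (outputSet m s)) v =
            insert e (D.inEdges (outputSet m s) v) by
              rw [inEdges, Finset.filter_insert, if_pos rfl]; rfl]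
          exact hg.accept hheP hXA haug.excess_eq
    · have ht' : s₁.arr 9 (D.tail e) ≠ s.var 4 := by
        intro h
        refine ht ?_
        change s₁.arr 9 (s₁.arr 0 (s₁.var 5)) = s₁.var 4
        rwa [h0, h5, hte, h4]
      refine ⟨s₁, 1, .skip s₁, by omega, hsearch.le, ?_⟩
      rw [hout1, h8]
      refine hinv.insert heP hmin (fun a => Or.inl rfl) subset_rfl (fun f hf => Or.inl hf)
        fun _ => ?_
      let R : Finset (Fin n) := Finset.univ.filter fun u => s₁.arr 9 u = s.var 4
      have hR : ∀ u, u ∈ R ↔ s₁.arr 9 u = s.var 4 := fun u => by simp [R]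
      refine hg.reject hheP (hinv.weight_le heP) (R := R) ?_ ?_ fun f hf hfR => ?_
      · rw [hR, hsearch.reached_iff]
        exact ⟨0, hsearch.pos, by rw [hsearch.root, hroot]⟩
      · rw [hR]; exact ht'
      · rw [hR] at hfR ⊢
        refine hclosed f f.2 _ _ (residualArc_iff.2 ⟨Or.inr ?_, rfl, rfl⟩) hfR
        simpa [avoiding, Fin.ext_iff] using hf
  · unfold processCost
    nlinarith

/-- The set of the processed edges, read off from array 7. -/
def doneSet (m : ℕ) (s : State) : Finset (Fin m) := Finset.univ.filter fun e => s.arr 7 e = 1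

variable (D w) in
/-- The state at the beginning of a round. -/
structure RoundInv (s : State) : Prop where
  lists : HasLists m (tailArray D) (headArray D) s
  root : s.var 2 = D.root
  done : ∀ a < m, s.arr 7 a = 0 ∨ s.arr 7 a = 1
  card : (doneSet m s).card = s.var 4
  reached_le : ∀ u, s.arr 9 u ≤ s.var 4
  greedy : GreedyInv D w (doneSet m s) (outputSet m s) (s.arr 8)

/-- The coefficient of the linear time bound for one round. -/
def roundCost : ℕ :=
  roundInit.bound + selectCost + selectInitCost + (Program.store 7 edge (.const 1)).bound +
    processCost

theorem terminates_roundStep (h : RoundInv D w s) (hlt : s.var 4 < m) :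
    Terminates (ofFin w) roundStep s (roundCost * (m + 1)) fun s' =>
      RoundInv D w s' ∧ s'.var 4 = s.var 4 + 1 := by
  refine (Terminates.seq (T := roundInit.bound) (T' := (selectCost * m + selectInitCost) +
    ((Program.store 7 edge (.const 1)).bound + processCost * (m + 1)))
    (terminates_of_loopFree rfl ?_)).mono (by unfold roundCost; nlinarith) fun s' hs' => hs'
  have h1 : roundInit.exec (ofFin w) s = ⟨Function.update s.var 4 (s.var 4 + 1), s.arr⟩ := by
    simp [roundInit, Program.exec, Expr.eval]
  rw [h1]
  set s₁ : State := ⟨Function.update s.var 4 (s.var 4 + 1), s.arr⟩ with hs₁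
  have hex : ∃ a < m, s₁.arr 7 a = 0 := by
    by_contra! hcon
    have : doneSet m s = Finset.univ := Finset.eq_univ_iff_forall.2 fun e =>
      Finset.mem_filter.2 ⟨Finset.mem_univ _, (h.done e e.2).resolve_left (hcon e e.2)⟩
    have hc := h.card
    rw [this, Finset.card_univ, Fintype.card_fin] at hc
    omega
  refine Terminates.seq ((terminates_select (w := ofFin w) (s := s₁) (m := m)
    (hd := headArray D) (by simpa [hs₁] using h.lists.edgeCount) h.lists.head hex).frame.mono
      le_rfl ?_)
  rintro s₂ ⟨hf2, hem, hdone, hmin⟩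
  obtain ⟨e, he⟩ : ∃ e : Fin m, (e : ℕ) = s₂.var 5 := ⟨⟨_, hem⟩, rfl⟩
  rw [← he] at hdone hmin
  have harr2 : s₂.arr = s.arr := by
    funext a
    rw [hf2.arr a (by simp [select, selectStep, Program.stores])]
  refine Terminates.seq (terminates_of_loopFree rfl ?_)
  have h3 : (Program.store 7 edge (.const 1)).exec (ofFin w) s₂ =
      ⟨s₂.var, Function.update s.arr 7 (Function.update (s.arr 7) e 1)⟩ := by
    simp [Program.exec, Expr.eval, harr2, he]
  rw [h3]
  set s₃ : State := ⟨s₂.var, Function.update s.arr 7 (Function.update (s.arr 7) e 1)⟩ with hs₃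
  have hvar3 : ∀ x, x ≠ 3 → x ≠ 4 → x ≠ 5 → s₃.var x = s.var x := fun x h3 h4 h5 => by
    rw [show s₃.var x = s₂.var x from rfl,
      hf2.var x (by simp [select, selectStep, Program.assigns, h3, h5])]
    simp [hs₁, h4]
  have h43 : s₃.var 4 = s.var 4 + 1 := by
    rw [show s₃.var 4 = s₂.var 4 from rfl, hf2.var 4 (by decide)]
    simp [hs₁]
  have harr3 : ∀ a, a ≠ 7 → s₃.arr a = s.arr a := fun a ha => by simp [hs₃, ha]
  have hlists3 : HasLists m (tailArray D) (headArray D) s₃ :=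
    h.lists.congr (hvar3 1 (by decide) (by decide) (by decide)) fun a ha _ => harr3 a (by omega)
  have hroot3 : s₃.var 2 = D.root := (hvar3 2 (by decide) (by decide) (by decide)).trans h.root
  have hout3 : outputSet m s₃ = outputSet m s := by
    unfold outputSet; rw [harr3 2 (by decide)]
  have heP : e ∉ doneSet m s := fun h' => by
    have : s.arr 7 e = 1 := (Finset.mem_filter.1 h').2
    rw [show s₁.arr 7 e = s.arr 7 e from rfl] at hdone
    omega
  refine ((terminates_processEdge (D := D) (w := w) (s := s₃) (P := doneSet m s) hlists3 hroot3
    (fun u => ?_) he.symm ?_ heP fun f hf => ?_).frame).mono le_rfl ?_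
  · rw [harr3 9 (by decide), h43]
    exact Nat.lt_succ_of_le (h.reached_le u)
  · rw [hout3, harr3 8 (by decide)]
    exact h.greedy
  · refine hmin f f.2 ((h.done f f.2).resolve_right fun h' => hf ?_)
    exact Finset.mem_filter.2 ⟨Finset.mem_univ _, h'⟩
  · rintro s₄ ⟨hf4, hle4, hinv4⟩
    have hvar4 : ∀ x < 6, s₄.var x = s₃.var x := fun x hx => by
      have e6 : x ≠ 6 := by omega
      have e7 : x ≠ 7 := by omega
      have e8 : x ≠ 8 := by omega
      have e9 : x ≠ 9 := by omega
      exact hf4.var x (by simp [processEdge, augment, augmentStep, search, searchInit, searchStep,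
        scan, scanStep, Program.assigns, e6, e7, e8, e9])
    have harr4 : ∀ a < 8, a ≠ 2 → s₄.arr a = s₃.arr a := fun a ha e2 => by
      have e8 : a ≠ 8 := by omega
      have e9 : a ≠ 9 := by omega
      have e10 : a ≠ 10 := by omega
      have e11 : a ≠ 11 := by omega
      exact hf4.arr a (by simp [processEdge, augment, augmentStep, search, searchInit, searchStep,
        scan, scanStep, Program.stores, e2, e8, e9, e10, e11])
    have h7 : s₄.arr 7 = Function.update (s.arr 7) e 1 := by
      rw [harr4 7 (by decide) (by decide)]; simp [hs₃]
    have h44 : s₄.var 4 = s.var 4 + 1 := (hvar4 4 (by decide)).trans h43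
    have hdone4 : doneSet m s₄ = insert e (doneSet m s) := by
      ext f
      simp only [doneSet, Finset.mem_filter, Finset.mem_univ, true_and, Finset.mem_insert, h7]
      by_cases hfe : f = e
      · simp [hfe]
      · have : (f : ℕ) ≠ e := fun h => hfe (Fin.ext h)
        simp [hfe, this]
    refine ⟨⟨hlists3.congr (hvar4 1 (by decide)) fun a ha h2 => harr4 a (by omega) h2,
      (hvar4 2 (by decide)).trans hroot3, fun a ha => ?_, ?_, ?_, ?_⟩, h44⟩
    · rw [h7]
      by_cases hae : a = e
      · simp [hae]
      · simpa [hae] using h.done a ha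
    · rw [hdone4, Finset.card_insert_of_notMem heP, h.card, h44]
    · rw [h44, ← h43]; exact hle4
    · rw [hdone4]; exact hinv4

theorem RoundInv.isMinWeightMaximalFlame (hD : D.Acyclic) (h : RoundInv D w s)
    (hm : m ≤ s.var 4) : D.IsMinWeightMaximalFlame w (outputSet m s) := by
  have huniv : doneSet m s = Finset.univ := by
    refine Finset.eq_univ_of_card _ (le_antisymm (Finset.card_le_univ _) ?_)
    rw [Fintype.card_fin, h.card]
    exact hm
  have hg := h.greedy
  rw [huniv] at hg
  refine isMinWeightMaximalFlame_of_greedy hD hg.head_ne_root fun v hv => ?_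
  obtain ⟨x, hx, -⟩ := hg.greedy v hv
  exact ⟨x, hx⟩

/-- Up to a factor, the coefficient of the quadratic time bound for the program. -/
def programCost : ℕ :=
  buildCost + roundCost + (Test.lt round edgeCount).cost + 1

theorem terminates_program (hD : D.Acyclic) (w : Fin m → ℚ≥0) :
    Terminates (ofFin w) program (inputState D) (4 * programCost * (m ^ 2 + 1)) fun s =>
      D.IsMinWeightMaximalFlame w (outputSet m s) := by
  let loopCost := (Test.lt round edgeCount).cost + 1
  let Φ : State → ℕ := fun s => (roundCost * (m + 1) + loopCost) * (m - s.var 4)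
  refine (Terminates.seq (T := buildCost * (m + 1))
    (T' := (roundCost * (m + 1) + loopCost) * m + loopCost)
    ((terminates_build (m := m) (tl := tailArray D) (hd := headArray D) rfl rfl rfl rfl
      (fun _ => rfl) fun _ => rfl).frame.mono le_rfl ?_)).mono ?_ fun s' hs' => hs'
  · rintro s₁ ⟨hf, hlists⟩
    have h4 : s₁.var 4 = 0 := hf.var 4 (by decide)
    have harr : ∀ a, 6 < a → s₁.arr a = fun _ => 0 := fun a ha => by
      have e3 : a ≠ 3 := by omega
      have e4 : a ≠ 4 := by omega
      have e5 : a ≠ 5 := by omega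
      have e6 : a ≠ 6 := by omega
      rw [hf.arr a (by simp [build, buildStep, Program.stores, e3, e4, e5, e6])]
      obtain ⟨b, rfl⟩ := Nat.exists_eq_add_of_lt ha
      rw [show 6 + b + 1 = b + 7 by omega]
      rfl
    have hout : s₁.arr 2 = fun _ => 0 := hf.arr 2 (by decide)
    have hdone : doneSet m s₁ = ∅ := by simp [doneSet, harr 7 (by decide)]
    have hI : RoundInv D w s₁ := by
      refine ⟨hlists, hf.var 2 (by decide), fun a _ => ?_, ?_, fun u => ?_, ?_⟩
      · rw [harr 7 (by decide)]; exact Or.inl rfl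
      · rw [hdone, h4]; rfl
      · rw [harr 9 (by decide)]; exact Nat.zero_le _
      · rw [hdone, harr 8 (by decide), show outputSet m s₁ = ∅ by simp [outputSet, hout]]
        exact GreedyInv.init
    refine (Terminates.loop (RoundInv D w) Φ hI ?_).mono ?_ ?_
    · intro s₂ _ hI2 hlt
      replace hlt : s₂.var 4 < s₂.var 1 := hlt
      rw [hI2.lists.edgeCount] at hlt
      refine ⟨roundCost * (m + 1), (terminates_roundStep hI2 hlt).mono le_rfl ?_⟩
      rintro s₃ ⟨hI3, h43⟩
      refine ⟨hI3, ?_⟩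
      simp only [Φ, h43]
      obtain ⟨k, hk⟩ := Nat.exists_eq_add_of_lt hlt
      rw [show m - (s₂.var 4 + 1) = k by omega, show m - s₂.var 4 = k + 1 by omega,
        Nat.mul_succ (_ + _)]
      simp only [loopCost]
      omega
    · simp only [Φ, h4, Nat.sub_zero, loopCost]; omega
    · rintro s₂ ⟨-, hI2, hend⟩
      replace hend : ¬ s₂.var 4 < s₂.var 1 := hend
      rw [hI2.lists.edgeCount] at hend
      exact hI2.isMinWeightMaximalFlame hD (not_lt.1 hend)
  · have h1 : buildCost * (m + 1) + ((roundCost * (m + 1) + loopCost) * m + loopCost) ≤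
        programCost * (m + 1) ^ 2 := by
      unfold programCost
      simp only [loopCost]
      nlinarith [Nat.zero_le (buildCost * m ^ 2), Nat.zero_le (buildCost * m),
        Nat.zero_le (roundCost * m), Nat.zero_le ((Test.lt round edgeCount).cost * m ^ 2),
        Nat.zero_le ((Test.lt round edgeCount).cost * m), Nat.zero_le (m ^ 2)]
    have h2 : (m + 1) ^ 2 ≤ 4 * (m ^ 2 + 1) := by
      rcases Nat.eq_zero_or_pos m with rfl | hm
      · norm_num
      · nlinarith
    calc _ ≤ programCost * (m + 1) ^ 2 := h1
      _ ≤ programCost * (4 * (m ^ 2 + 1)) := Nat.mul_le_mul_left _ h2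
      _ = _ := by ring

end Flame

end RAM

theorem mainTheorem6 :
    ∃ (A : RAM.Program) (C : ℕ),
      ∀ (n m : ℕ) (D : RootedDigraph (Fin n) (Fin m)) (w : Fin m → ℚ≥0), D.Acyclic →
        ∃ (s : RAM.State) (t : ℕ),
          RAM.Runs (RAM.ofFin w) A (RAM.inputState D) s t ∧
          t ≤ C * (m ^ 2 + 1) ∧
          D.IsMinWeightMaximalFlame w (RAM.outputSet m s) := by
  exact ⟨RAM.Flame.program, 4 * RAM.Flame.programCost, fun _ _ _ w hD =>
    RAM.Flame.terminates_program hD w⟩
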